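/- Let $L\ge 0$, $K\ge 1$, $M,\tau_p$ be integers; there are $L$ access points (APs) with $M$ antennas, $K$ single-antenna users and one single-antenna eavesdropper $E$ that attacks user $1$. Let $\beta_{l,k}>0$, $\beta_{l,E}\ge 0$, $\rho_u>0$, $\rho_E\ge0$, $\rho_{l,k}\ge 0$, let $\boldsymbol\phi_1,\dots,\boldsymbol\phi_K\in\mathbb C^{\tau_p}$ be orthonormal, and for each AP $l$ let $\mathcal S_l\subseteq\{1,\dots,K\}$ (strong users; the others are weak) satisfy $|\mathcal S_l|<M$. *Channels and training.* $\mathbf h_{l,k}=\sqrt{\beta_{l,k}}\,\mathbf g_{l,k}$ and $\mathbf h_{l,E}=\sqrt{\beta_{l,E}}\,\mathbf g_{l,E}$ in $\mathbb C^M$; AP $l$ receives $$\mathbf Y_l=\sqrt{\tau_p\rho_u}\sum_{k}\mathbf h_{l,k}\boldsymbol\phi_k^{\mathrm H}+\sqrt{\tau_p\rho_E}\,\mathbf h_{l,E}\boldsymbol\phi_1^{\mathrm H}+\mathbf N_l ,$$ where all entries of all $\mathbf g_{l,k},\mathbf g_{l,E},\mathbf N_l$ are i.i.d. $\mathcal{CN}(0,1)$.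 Put $v_{l,k}=\tau_p\rho_u\beta_{l,k}+1$ for $k\ne1$ and $v_{l,1}=\tau_p\rho_u\beta_{l,1}+\tau_p\rho_E\beta_{l,E}+1$. The MMSE channel estimate is $\hat{\mathbf h}_{l,k}=\frac{\sqrt{\tau_p\rho_u}\,\beta_{l,k}}{v_{l,k}}\mathbf Y_l\boldsymbol\phi_k$; put $\gamma_{l,k}=\tau_p\rho_u\beta_{l,k}^2/v_{l,k}$. *PPZF precoding.* Let $\mathbf A_l$ be the matrix with columns $\hat{\mathbf h}_{l,i}$, $i\in\mathcal S_l$. Let $\mathbf u_{l,k}$ be the column of $\mathbf A_l(\mathbf A_l^{\mathrm H}\mathbf A_l)^{-1}$ belonging to $k$ if $k\in\mathcal S_l$ (partial zero-forcing), and $\mathbf u_{l,k}=(\mathbf I_M-\mathbf A_l(\mathbf A_l^{\mathrm H}\mathbf A_l)^{-1}\mathbf A_l^{\mathrm H})\hat{\mathbf h}_{l,k}$ if $k\notin\mathcal S_l$ (protective MRT), and let $\mathbf w_{l,k}=\mathbf u_{l,k}/\sqrt{\mathbb E\|\mathbf u_{l,k}\|^2}$. With data symbols $s_t$, user $k$ receives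 $z_k=\sum_l\mathbf h_{l,k}^{\mathrm H}\sum_t\sqrt{\rho_{l,t}}\,\mathbf w_{l,t}s_t+n_k$. *Spectral efficiency.* Let $\mathrm{UI}_{k,t}=\sum_l\sqrt{\rho_{l,t}}\,\mathbf h_{l,k}^{\mathrm H}\mathbf w_{l,t}$, $\mathrm{CP}_k=\sum_l\sqrt{\rho_{l,k}}\,\mathbb E\{\mathbf h_{l,k}^{\mathrm H}\mathbf w_{l,k}\}$, $\mathrm{PU}_k=\mathrm{UI}_{k,k}-\mathrm{CP}_k$, and $$R_k=\log_2(1+\mathrm{SINR}_k),\qquad \mathrm{SINR}_k=\frac{|\mathrm{CP}_k|^2}{\mathbb E|\mathrm{PU}_k|^2+\sum_{t\ne k}\mathbb E|\mathrm{UI}_{k,t}|^2+1}.$$ **Proposition.** For every user $k$: $\mathbb E\|\mathbf w_{l,t}\|^2=1$ for all $l,t$, all the expectations above exist and are finite, and $$\mathrm{SINR}_k=\frac{\Big(\sum_{l=1}^L\sqrt{(M-|\mathcal S_l|)\,\rho_{l,k}\gamma_{l,k}}\Big)^2}{\sum_{t=1}^K\sum_{l=1}^L\rho_{l,t}(\beta_{l,k}-\delta_{l,k}\gamma_{l,k})+1},$$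 where $\delta_{l,k}=1$ if $k\in\mathcal S_l$ and $\delta_{l,k}=0$ otherwise; hence $R_k$ is $\log_2(1+\cdot)$ of this expression. Moreover $R_k$ is achievable: if $s_k\sim\mathcal{CN}(0,1)$, the symbols satisfy $\mathbb E|s_t|^2=1$ and $\mathbb E\{s_t s_{t'}^*\}=0$ for $t\neq t'$, $n_k\sim\mathcal{CN}(0,1)$, and the symbol vector, $n_k$ and the channels together with the training noise are independent, then the mutual information (in bits) satisfies $I(s_k;z_k)\ge R_k$. -/

import Mathlib

open MeasureTheory ProbabilityTheory Matrix
open scoped ENNReal NNReal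

noncomputable section

namespace CellFree

/-- The law `CN(0, 1)`: real and imaginary parts are independent `N(0, 1/2)`. -/
def stdComplexGaussian : Measure ℂ :=
  ((gaussianReal 0 (1 / 2)).prod (gaussianReal 0 (1 / 2))).map (fun p : ℝ × ℝ => (⟨p.1, p.2⟩ : ℂ))

/-- Deterministic parameters of a network with `L` access points of `M` antennas each,
`K` single-antenna users, one single-antenna eavesdropper and pilots of length `τ`. -/
structure Params (L K M τ : ℕ) where
  /-- large-scale fading coefficient between AP `l` and user `k` -/
  β : Fin L → Fin K → ℝ
  /-- large-scale fading coefficient between AP `l` and the eavesdropper -/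
  βE : Fin L → ℝ
  /-- uplink SNR of the users -/
  ρu : ℝ
  /-- uplink SNR of the eavesdropper -/
  ρE : ℝ
  /-- downlink power control coefficients -/
  ρ : Fin L → Fin K → ℝ
  /-- pilot sequences of the users -/
  φ : Fin K → EuclideanSpace ℂ (Fin τ)
  /-- `S l` is the set of strong users of AP `l`; the weak users are the other ones -/
  S : Fin L → Finset (Fin K)

/-- The random variables of a coherence block that the transmitters' signals depend on:
small-scale fading of the users and of the eavesdropper, and noise in the training phase. -/
structure Block (L K M τ : ℕ) (Ω : Type*) where
  g : Fin L → Fin K → Fin M → Ω → ℂ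
  gE : Fin L → Fin M → Ω → ℂ
  N : Fin L → Fin M → Fin τ → Ω → ℂ

variable {L K M τ : ℕ} {Ω : Type*}

/-- All scalar random variables of a block as a single family. -/
def Block.family (X : Block L K M τ Ω) :
    (Fin L × Fin K × Fin M) ⊕ (Fin L × Fin M) ⊕ (Fin L × Fin M × Fin τ) → Ω → ℂ
  | .inl (l, k, m) => X.g l k m
  | .inr (.inl (l, m)) => X.gE l m
  | .inr (.inr (l, m, i)) => X.N l m i

/-- All small-scale fading coefficients and all training noise samples are
independent and `CN(0, 1)`-distributed. -/
structure Block.IsRayleigh [MeasurableSpace Ω] (X : Block L K M τ Ω) (μ : Measure Ω) : Prop where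
  measurable : ∀ i, Measurable (X.family i)
  law : ∀ i, μ.map (X.family i) = stdComplexGaussian
  indep : iIndepFun X.family μ

namespace Params

variable (P : Params L K M τ) (X : Block L K M τ Ω)

/-- Channel vector between AP `l` and user `k`. -/
def h (l : Fin L) (k : Fin K) (ω : Ω) : Fin M → ℂ :=
  fun m => (√(P.β l k) : ℂ) * X.g l k m ω

/-- Channel vector between AP `l` and the eavesdropper. -/
def hE (l : Fin L) (ω : Ω) : Fin M → ℂ :=
  fun m => (√(P.βE l) : ℂ) * X.gE l m ω

/-- Pilot matrix received by AP `l`. User `0` is the one under attack: the eavesdropper sends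
the pilot of that user. -/
def Y [NeZero K] (l : Fin L) (ω : Ω) : Matrix (Fin M) (Fin τ) ℂ :=
  (√(τ * P.ρu) : ℂ) • ∑ k, vecMulVec (P.h X l k ω) (star (P.φ k).ofLp)
    + (√(τ * P.ρE) : ℂ) • vecMulVec (P.hE X l ω) (star (P.φ 0).ofLp)
    + Matrix.of fun m i => X.N l m i ω

/-- Variance of the signal-plus-noise in the pilot direction of user `k` at AP `l`. -/
def pilotVar [NeZero K] (l : Fin L) (k : Fin K) : ℝ :=
  if k = 0 then τ * P.ρu * P.β l k + τ * P.ρE * P.βE l + 1 else τ * P.ρu * P.β l k + 1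

/-- MMSE estimate of the channel between AP `l` and user `k`. -/
def hhat [NeZero K] (l : Fin L) (k : Fin K) (ω : Ω) : Fin M → ℂ :=
  ((√(τ * P.ρu) * P.β l k / P.pilotVar l k : ℝ) : ℂ) • (P.Y X l ω *ᵥ (P.φ k).ofLp)

/-- Variance of the entries of the channel estimate. -/
def γ [NeZero K] (l : Fin L) (k : Fin K) : ℝ :=
  τ * P.ρu * P.β l k ^ 2 / P.pilotVar l k

/-- Matrix whose columns are the channel estimates of the strong users of AP `l`. -/
def HS [NeZero K] (l : Fin L) (ω : Ω) : Matrix (Fin M) (P.S l) ℂ :=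
  Matrix.of fun m i => P.hhat X l i ω m

/-- Projection onto the orthogonal complement of the estimates of the strong users. -/
def B [NeZero K] (l : Fin L) (ω : Ω) : Matrix (Fin M) (Fin M) ℂ :=
  1 - P.HS X l ω * ((P.HS X l ω)ᴴ * P.HS X l ω)⁻¹ * (P.HS X l ω)ᴴ

/-- Precoding vector before normalization: partial zero-forcing for a strong user of AP `l`,
protective maximum-ratio transmission for a weak user. -/
def u [NeZero K] (l : Fin L) (k : Fin K) (ω : Ω) : Fin M → ℂ :=
  if hk : k ∈ P.S l then
    (P.HS X l ω * ((P.HS X l ω)ᴴ * P.HS X l ω)⁻¹) *ᵥ Pi.single ⟨k, hk⟩ 1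
  else
    P.B X l ω *ᵥ P.hhat X l k ω

variable [MeasurableSpace Ω] (μ : Measure Ω)

/-- PPZF precoding vector of AP `l` for user `k`. -/
def w [NeZero K] (l : Fin L) (k : Fin K) (ω : Ω) : Fin M → ℂ :=
  ((1 / √(∫ ω', ∑ m, ‖P.u X l k ω' m‖ ^ 2 ∂μ) : ℝ) : ℂ) • P.u X l k ω

/-- Signal sent by AP `l` when the data symbols are `s`. -/
def x [NeZero K] (s : Fin K → Ω → ℂ) (l : Fin L) (ω : Ω) : Fin M → ℂ :=
  ∑ t, ((√(P.ρ l t) : ℂ) * s t ω) • P.w X μ l t ω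

/-- Signal received by user `k`, whose receiver noise is `n`. -/
def z [NeZero K] (s : Fin K → Ω → ℂ) (n : Ω → ℂ) (k : Fin K) (ω : Ω) : ℂ :=
  ∑ l, star (P.h X l k ω) ⬝ᵥ P.x X μ s l ω + n ω

/-- Coherent precoding gain of user `k`. -/
def CP [NeZero K] (k : Fin K) : ℂ :=
  ∑ l, (√(P.ρ l k) : ℂ) * ∫ ω, star (P.h X l k ω) ⬝ᵥ P.w X μ l k ω ∂μ

/-- Precoding gain uncertainty of user `k`. -/
def PU [NeZero K] (k : Fin K) (ω : Ω) : ℂ :=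
  ∑ l, ((√(P.ρ l k) : ℂ) * (star (P.h X l k ω) ⬝ᵥ P.w X μ l k ω)
    - (√(P.ρ l k) : ℂ) * ∫ ω', star (P.h X l k ω') ⬝ᵥ P.w X μ l k ω' ∂μ)

/-- Interference at user `k` from the signal intended for user `t`. -/
def UI [NeZero K] (k t : Fin K) (ω : Ω) : ℂ :=
  ∑ l, (√(P.ρ l t) : ℂ) * (star (P.h X l k ω) ⬝ᵥ P.w X μ l t ω)

/-- Effective SINR of user `k`, who only has statistical channel knowledge. -/
def SINR [NeZero K] (k : Fin K) : ℝ :=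
  ‖P.CP X μ k‖ ^ 2 /
    ((∫ ω, ‖P.PU X μ k ω‖ ^ 2 ∂μ)
      + (∑ t ∈ Finset.univ.erase k, ∫ ω, ‖P.UI X μ k t ω‖ ^ 2 ∂μ) + 1)

/-- Downlink spectral efficiency of user `k` in bit/s/Hz. -/
def SE [NeZero K] (k : Fin K) : ℝ := Real.logb 2 (1 + P.SINR X μ k)

/-- Indicator of `k` being a strong user of AP `l`. -/
def δ (l : Fin L) (k : Fin K) : ℝ := if k ∈ P.S l then 1 else 0

end Params

/-- Mutual information between two random variables, in bits. -/
def mutualInfo [MeasurableSpace Ω] {A C : Type*} [MeasurableSpace A] [MeasurableSpace C]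
    (U : Ω → A) (V : Ω → C) (μ : Measure Ω) : ℝ≥0∞ :=
  InformationTheory.klDiv (μ.map fun ω => (U ω, V ω)) ((μ.map U).prod (μ.map V))
    / ENNReal.ofReal (Real.log 2)

/-- The data symbols `s` and the noise `n` of user `k`: the symbols have unit power and are
mutually uncorrelated, the symbol of user `k` is `CN(0, 1)`, the noise is `CN(0, 1)`, and symbols,
noise and the random variables of the block are independent of one another. -/
structure IsDownlinkInput [MeasurableSpace Ω] (X : Block L K M τ Ω) (μ : Measure Ω)
    (k : Fin K) (s : Fin K → Ω → ℂ) (n : Ω → ℂ) : Prop where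
  measurable_s : ∀ t, Measurable (s t)
  measurable_n : Measurable n
  power : ∀ t, ∫ ω, ‖s t ω‖ ^ 2 ∂μ = 1
  uncorrelated : ∀ t t', t ≠ t' → ∫ ω, s t ω * star (s t' ω) ∂μ = 0
  law_s : μ.map (s k) = stdComplexGaussian
  law_n : μ.map n = stdComplexGaussian
  indep_s : IndepFun (fun ω t => s t ω) (fun ω i => X.family i ω) μ
  indep_n : IndepFun n (fun ω => ((fun t => s t ω), (fun i => X.family i ω))) μ

end CellFree

end

/-!
At a fixed access point the MMSE estimates `ĥ_k` are independent Gaussian vectors with covariance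
`γ_k I`, and the estimation error `h_k - ĥ_k` is Gaussian with covariance `(β_k - γ_k) I` and
independent of all estimates, hence of all precoders. It therefore adds `β_k - γ_k` to the variance
of every gain `h_kᴴ w_t`. What is left is `ĥ_kᴴ w_t`. For a strong user `k` it is deterministic: it
vanishes for `t ≠ k`, and for `t = k` it is the reciprocal of the root of the expected squared norm
of the dual vector. That squared norm is the inverse of the squared norm of the projection of `ĥ_k`
onto the `M - |S| + 1` dimensions orthogonal to the other strong estimates, and integrating Gaussian
Laplace transforms gives its expectation `1 / ((M - |S|) γ_k)`. For a weak user, `ĥ_k` is projected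
onto `M - |S|` dimensions independently of the strong estimates, and the gain has mean
`√((M - |S|) γ_k)` and variance `γ_k` for `t = k`, mean `0` and variance `γ_k` for `t ≠ k`. Distinct
access points are independent, so the variances add up.

For achievability, the Gibbs variational principle bounds `I(s; z)` from below by the expected
log-likelihood ratio of any reference channel. Taking `z = A s + CN(0, D)` with `A` the mean gain
and `D` the mean power of `z - A s`, this expectation is exactly `log(1 + |A|² / D)`.
-/

noncomputable section

namespace CellFree

/-- The real random variable `f` is integrable with expectation `c`. -/
structure HasMean {Ω : Type*} [MeasurableSpace Ω] (f : Ω → ℝ) (c : ℝ) (μ : Measure Ω) : Prop where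
  integrable : Integrable f μ
  mean : ∫ ω, f ω ∂μ = c

/-- The complex random variable `f` is square-integrable with expectation `a` and variance
`E|f - a|² = v`. -/
structure HasMeanVariance {Ω : Type*} [MeasurableSpace Ω] (f : Ω → ℂ) (a : ℂ) (v : ℝ)
    (μ : Measure Ω) : Prop where
  memLp : MemLp f 2 μ
  mean : ∫ ω, f ω ∂μ = a
  variance : ∫ ω, ‖f ω - a‖ ^ 2 ∂μ = v

section Moments

variable {Ω Ω' : Type*} [MeasurableSpace Ω] [MeasurableSpace Ω'] {μ : Measure Ω}

lemma hasMean_of_lintegral_ofReal_eq {f : Ω → ℝ} (hf : AEStronglyMeasurable f μ)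
    (h0 : 0 ≤ᵐ[μ] f) {c : ℝ} (hc : 0 ≤ c) (h : ∫⁻ ω, ENNReal.ofReal (f ω) ∂μ = ENNReal.ofReal c) :
    HasMean f c μ where
  integrable := by
    refine ⟨hf, ?_⟩
    rw [hasFiniteIntegral_iff_ofReal h0, h]
    exact ENNReal.ofReal_lt_top
  mean := by rw [integral_eq_lintegral_of_nonneg_ae h0 hf, h, ENNReal.toReal_ofReal hc]

lemma HasMean.const_mul {f : Ω → ℝ} {c : ℝ} (h : HasMean f c μ) (r : ℝ) :
    HasMean (fun ω => r * f ω) (r * c) μ :=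
  ⟨h.integrable.const_mul r, by rw [integral_const_mul, h.mean]⟩

lemma HasMeanVariance.of_map {T : Ω → Ω'} {f : Ω' → ℂ} {a : ℂ} {v : ℝ} (hT : Measurable T)
    (h : HasMeanVariance f a v (μ.map T)) : HasMeanVariance (fun ω => f (T ω)) a v μ where
  memLp := h.memLp.comp_measurePreserving (hT.measurePreserving μ)
  mean := by rw [← h.mean, integral_map hT.aemeasurable h.memLp.aestronglyMeasurable]
  variance := by
    rw [← h.variance]
    exact (integral_map hT.aemeasurable
      ((h.memLp.aestronglyMeasurable.sub aestronglyMeasurable_const).norm.pow 2)).symm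

lemma HasMeanVariance.congr {f g : Ω → ℂ} {a : ℂ} {v : ℝ} (h : HasMeanVariance f a v μ)
    (hfg : f =ᵐ[μ] g) : HasMeanVariance g a v μ where
  memLp := h.memLp.ae_eq hfg
  mean := by rw [← integral_congr_ae hfg, h.mean]
  variance := by
    rw [← integral_congr_ae (hfg.mono fun ω hω => congrArg (fun z => ‖z - a‖ ^ 2) hω), h.variance]

lemma HasMeanVariance.const_mul {f : Ω → ℂ} {a : ℂ} {v : ℝ} (h : HasMeanVariance f a v μ) (c : ℂ) :
    HasMeanVariance (fun ω => c * f ω) (c * a) (‖c‖ ^ 2 * v) μ where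
  memLp := h.memLp.const_mul c
  mean := by rw [integral_const_mul, h.mean]
  variance := by simp_rw [← mul_sub, norm_mul, mul_pow, integral_const_mul, h.variance]

end Moments

instance : IsProbabilityMeasure stdComplexGaussian := by
  unfold stdComplexGaussian
  exact Measure.isProbabilityMeasure_map
    (Complex.measurableEquivRealProd.symm.measurable.aemeasurable)

lemma stdComplexGaussian_eq_withDensity :
    stdComplexGaussian
      = volume.withDensity fun z : ℂ => ENNReal.ofReal (Real.pi⁻¹ * Real.exp (-‖z‖ ^ 2)) := by
  have hvar : (1 / 2 : ℝ≥0) ≠ 0 := by norm_num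
  have hmp := Complex.volume_preserving_equiv_real_prod.symm
  unfold stdComplexGaussian
  rw [gaussianReal_of_var_ne_zero _ hvar, prod_withDensity (by fun_prop) (by fun_prop)]
  ext s hs
  have hm : Measurable (fun p : ℝ × ℝ => (⟨p.1, p.2⟩ : ℂ)) :=
    Complex.measurableEquivRealProd.symm.measurable
  rw [Measure.map_apply hm hs, withDensity_apply _ (hm hs), withDensity_apply _ hs,
    ← hmp.setLIntegral_comp_preimage hs (by fun_prop)]
  refine lintegral_congr fun p => ?_
  rw [gaussianPDF, gaussianPDF, ← ENNReal.ofReal_mul (gaussianPDFReal_nonneg _ _ _)]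
  congr 1
  simp only [gaussianPDFReal, Complex.measurableEquivRealProd_symm_apply]
  have hscale : √(2 * Real.pi * ((1 / 2 : ℝ≥0) : ℝ)) = √Real.pi := by
    congr 1
    push_cast
    ring
  rw [hscale, mul_mul_mul_comm, ← Real.exp_add, ← mul_inv, Real.mul_self_sqrt Real.pi_pos.le,
    Complex.sq_norm, Complex.normSq_mk]
  congr 2
  push_cast
  ring

instance : NullSingletonClass stdComplexGaussian := by
  rw [stdComplexGaussian_eq_withDensity]
  infer_instance

lemma lintegral_stdComplexGaussian {f : ℂ → ℝ≥0∞} (hf : Measurable f) :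
    ∫⁻ z, f z ∂stdComplexGaussian
      = ∫⁻ z, ENNReal.ofReal (Real.pi⁻¹ * Real.exp (-‖z‖ ^ 2)) * f z := by
  rw [stdComplexGaussian_eq_withDensity, lintegral_withDensity_eq_lintegral_mul _ (by fun_prop) hf]
  rfl

lemma lintegral_norm_pow_mul_exp (n : ℕ) {b : ℝ} (hb : 0 < b) :
    ∫⁻ z : ℂ, ENNReal.ofReal (‖z‖ ^ (2 * n) * Real.exp (-b * ‖z‖ ^ 2))
      = ENNReal.ofReal (Real.pi * n.factorial / b ^ (n + 1)) := by
  have hintegral := Complex.integral_rpow_mul_exp_neg_mul_rpow (p := 2) (q := 2 * n) (by norm_num)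
    (by linarith [(Nat.cast_nonneg n : (0 : ℝ) ≤ n)]) hb
  have hexponent : -((2 * n : ℝ) + 2) / 2 = -((n + 1 : ℕ) : ℝ) := by push_cast; ring
  have hgamma : ((2 * n : ℝ) + 2) / 2 = n + 1 := by ring
  rw [hexponent, hgamma, Real.Gamma_nat_eq_factorial, Real.rpow_neg hb.le,
    Real.rpow_natCast] at hintegral
  have hnatPow (z : ℂ) : ‖z‖ ^ (2 * n : ℝ) * Real.exp (-b * ‖z‖ ^ (2 : ℝ))
      = ‖z‖ ^ (2 * n) * Real.exp (-b * ‖z‖ ^ 2) := by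
    rw [Real.rpow_two, ← Real.rpow_natCast ‖z‖ (2 * n)]
    push_cast
    rfl
  simp_rw [hnatPow] at hintegral
  have hpos : (2 * Real.pi / 2 * (b ^ (n + 1))⁻¹ * n.factorial : ℝ) ≠ 0 := by positivity
  rw [← ofReal_integral_eq_lintegral_ofReal _ (.of_forall fun z => by positivity), hintegral]
  · congr 1
    field_simp
  · by_contra hnot
    rw [integral_undef hnot] at hintegral
    exact hpos hintegral.symm

lemma lintegral_norm_pow_mul_exp_stdComplexGaussian (n : ℕ) {t : ℝ} (ht : 0 ≤ t) :
    ∫⁻ z, ENNReal.ofReal (‖z‖ ^ (2 * n) * Real.exp (-t * ‖z‖ ^ 2)) ∂stdComplexGaussian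
      = ENNReal.ofReal (n.factorial / (1 + t) ^ (n + 1)) := by
  rw [lintegral_stdComplexGaussian (by fun_prop)]
  have hdensity (z : ℂ) : ENNReal.ofReal (Real.pi⁻¹ * Real.exp (-‖z‖ ^ 2))
        * ENNReal.ofReal (‖z‖ ^ (2 * n) * Real.exp (-t * ‖z‖ ^ 2))
      = ENNReal.ofReal Real.pi⁻¹ *
        ENNReal.ofReal (‖z‖ ^ (2 * n) * Real.exp (-(1 + t) * ‖z‖ ^ 2)) := by
    rw [← ENNReal.ofReal_mul (by positivity), ← ENNReal.ofReal_mul (by positivity)]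
    congr 1
    rw [show -(1 + t) * ‖z‖ ^ 2 = -‖z‖ ^ 2 + -t * ‖z‖ ^ 2 by ring, Real.exp_add]
    ring
  simp_rw [hdensity]
  rw [lintegral_const_mul _ (by fun_prop), lintegral_norm_pow_mul_exp n (by positivity),
    ← ENNReal.ofReal_mul (by positivity)]
  congr 1
  field_simp

lemma lintegral_norm_pow_stdComplexGaussian (n : ℕ) :
    ∫⁻ z, ENNReal.ofReal (‖z‖ ^ (2 * n)) ∂stdComplexGaussian = ENNReal.ofReal n.factorial := by
  simpa using lintegral_norm_pow_mul_exp_stdComplexGaussian n le_rfl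

lemma charFunDual_stdComplexGaussian (L : StrongDual ℝ ℂ) :
    charFunDual stdComplexGaussian L = Complex.exp (-((L 1) ^ 2 + (L Complex.I) ^ 2 : ℝ) / 4) := by
  have hmap : stdComplexGaussian = ((gaussianReal 0 (1 / 2)).prod (gaussianReal 0 (1 / 2))).map
      (Complex.equivRealProdCLM.symm : ℝ × ℝ →L[ℝ] ℂ) := rfl
  rw [hmap, charFunDual_map, charFunDual_prod, charFunDual_eq_charFun_map_one,
    charFunDual_eq_charFun_map_one]
  have hre : ⇑((L.comp (Complex.equivRealProdCLM.symm : ℝ × ℝ →L[ℝ] ℂ)).comp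
      (.inl ℝ ℝ ℝ)) = fun x => L 1 * x := by
    funext x
    have hx : (⟨x, 0⟩ : ℂ) = x • (1 : ℂ) := by apply Complex.ext <;> simp
    change L (⟨x, 0⟩ : ℂ) = _
    rw [hx, map_smul, smul_eq_mul, mul_comm]
  have him : ⇑((L.comp (Complex.equivRealProdCLM.symm : ℝ × ℝ →L[ℝ] ℂ)).comp
      (.inr ℝ ℝ ℝ)) = fun x => L Complex.I * x := by
    funext x
    have hx : (⟨0, x⟩ : ℂ) = x • Complex.I := by apply Complex.ext <;> simp
    change L (⟨0, x⟩ : ℂ) = _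
    rw [hx, map_smul, smul_eq_mul, mul_comm]
  rw [hre, him, gaussianReal_map_const_mul, gaussianReal_map_const_mul, charFun_gaussianReal,
    charFun_gaussianReal, ← Complex.exp_add]
  congr 1
  push_cast
  simp
  ring

lemma integral_id_stdComplexGaussian : ∫ z, z ∂stdComplexGaussian = 0 := by
  have hneg : stdComplexGaussian.map (fun z => -z) = stdComplexGaussian := by
    have : IsProbabilityMeasure (stdComplexGaussian.map fun z => -z) :=
      Measure.isProbabilityMeasure_map (by fun_prop)
    refine Measure.ext_of_charFunDual (funext fun L => ?_)
    change charFunDual (stdComplexGaussian.map (-ContinuousLinearMap.id ℝ ℂ)) L = _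
    rw [charFunDual_map]
    simp [charFunDual_stdComplexGaussian]
  refine self_eq_neg.mp ?_
  conv_lhs => rw [← hneg]
  rw [integral_map (by fun_prop) (by fun_prop), integral_neg]

lemma hasMeanVariance_id_stdComplexGaussian :
    HasMeanVariance (fun z => z) 0 1 stdComplexGaussian := by
  have hpower : HasMean (fun z : ℂ => ‖z‖ ^ 2) 1 stdComplexGaussian :=
    hasMean_of_lintegral_ofReal_eq (by fun_prop) (.of_forall fun z => by positivity) zero_le_one
      (by simpa using lintegral_norm_pow_stdComplexGaussian 1)
  exact ⟨(memLp_two_iff_integrable_sq_norm (by fun_prop)).mpr hpower.integrable,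
    integral_id_stdComplexGaussian, by simpa using hpower.mean⟩

section Vector

variable {ι κ κ' : Type*} [Fintype ι] [Fintype κ']

/-- Law of a vector of independent `CN(0, 1)` entries. -/
abbrev stdComplexGaussianVec (ι : Type*) [Fintype ι] : Measure (ι → ℂ) :=
  Measure.pi fun _ => stdComplexGaussian

@[fun_prop]
lemma measurable_mulVec [Finite κ] (V : Matrix κ ι ℂ) : Measurable fun x : ι → ℂ => V *ᵥ x :=
  (continuous_const.matrix_mulVec continuous_id).measurable

lemma exists_eq_re_star_dotProduct (L : StrongDual ℝ (ι → ℂ)) :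
    ∃ d : ι → ℂ, ∀ v, L v = (star d ⬝ᵥ v).re := by
  classical
  refine ⟨fun a => ⟨L (Pi.single a 1), L (Pi.single a Complex.I)⟩, fun v => ?_⟩
  have hsingle (a : ι) : (Pi.single a (v a) : ι → ℂ)
      = (v a).re • (Pi.single a 1 : ι → ℂ) + (v a).im • (Pi.single a Complex.I : ι → ℂ) := by
    rw [← Pi.single_smul, ← Pi.single_smul, ← Pi.single_add]
    congr 1
    apply Complex.ext <;> simp
  conv_lhs => rw [← Finset.univ_sum_single v]
  rw [map_sum, dotProduct, Complex.re_sum]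
  refine Finset.sum_congr rfl fun a _ => ?_
  rw [hsingle, map_add, map_smul, map_smul]
  simp
  ring

lemma charFunDual_stdComplexGaussianVec {L : StrongDual ℝ (ι → ℂ)} {d : ι → ℂ}
    (hL : ∀ v, L v = (star d ⬝ᵥ v).re) :
    charFunDual (stdComplexGaussianVec ι) L = Complex.exp (-(star d ⬝ᵥ d) / 4) := by
  classical
  have hcoord (i : ι) (w : ℂ) : L.comp (.single ℝ (fun _ => ℂ) i) w = (star (d i) * w).re := by
    change L (Pi.single i w) = _
    rw [hL, dotProduct_single, Pi.star_apply]
  rw [charFunDual_pi]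
  simp_rw [charFunDual_stdComplexGaussian, ← Complex.exp_sum, ← Finset.sum_div,
    Finset.sum_neg_distrib, dotProduct]
  congr 3
  refine Finset.sum_congr rfl fun i _ => ?_
  rw [hcoord, hcoord, Pi.star_apply, Complex.star_def, ← Complex.normSq_eq_conj_mul_self]
  simp [Complex.normSq_apply]
  ring

lemma charFunDual_map_mulVec [Fintype κ] (V : Matrix κ ι ℂ) {L : StrongDual ℝ (κ → ℂ)}
    {d : κ → ℂ} (hL : ∀ v, L v = (star d ⬝ᵥ v).re) :
    charFunDual ((stdComplexGaussianVec ι).map fun x => V *ᵥ x) L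
      = Complex.exp (-(star d ⬝ᵥ (V * Vᴴ) *ᵥ d) / 4) := by
  change charFunDual ((stdComplexGaussianVec ι).map
    ((LinearMap.toContinuousLinearMap V.mulVecLin).restrictScalars ℝ)) L = _
  rw [charFunDual_map, charFunDual_stdComplexGaussianVec (d := Vᴴ *ᵥ d) fun v => ?_]
  · rw [star_mulVec, conjTranspose_conjTranspose, ← dotProduct_mulVec, mulVec_mulVec]
  · change L (V *ᵥ v) = _
    rw [hL, star_mulVec, conjTranspose_conjTranspose, dotProduct_mulVec]

lemma map_mulVec_eq_of_mul_conjTranspose_eq [Finite κ] {V : Matrix κ ι ℂ} {W : Matrix κ κ' ℂ}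
    (h : V * Vᴴ = W * Wᴴ) :
    (stdComplexGaussianVec ι).map (fun x => V *ᵥ x)
      = (stdComplexGaussianVec κ').map fun x => W *ᵥ x := by
  have := Fintype.ofFinite κ
  refine Measure.ext_of_charFunDual (funext fun L => ?_)
  obtain ⟨d, hd⟩ := exists_eq_re_star_dotProduct L
  rw [charFunDual_map_mulVec V hd, charFunDual_map_mulVec W hd, h]

lemma map_mulVec_eq_of_mul_conjTranspose_eq_one [Fintype κ] [DecidableEq κ] {V : Matrix κ ι ℂ}
    (h : V * Vᴴ = 1) :
    (stdComplexGaussianVec ι).map (fun x => V *ᵥ x) = stdComplexGaussianVec κ := by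
  rw [map_mulVec_eq_of_mul_conjTranspose_eq (W := (1 : Matrix κ κ ℂ)) (by simpa using h)]
  simp

/-- The squared Euclidean norm. The norm of the function space `ι → ℂ` is the maximum norm. -/
def sqNorm (x : ι → ℂ) : ℝ := ∑ i, ‖x i‖ ^ 2

@[fun_prop]
lemma continuous_sqNorm : Continuous (sqNorm : (ι → ℂ) → ℝ) := by
  unfold sqNorm
  fun_prop

@[fun_prop]
lemma measurable_sqNorm : Measurable (sqNorm : (ι → ℂ) → ℝ) := continuous_sqNorm.measurable

lemma sqNorm_nonneg (x : ι → ℂ) : 0 ≤ sqNorm x := Finset.sum_nonneg fun _ _ => sq_nonneg _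

lemma sqNorm_pos {x : ι → ℂ} (hx : x ≠ 0) : 0 < sqNorm x := by
  obtain ⟨i, hi⟩ := Function.ne_iff.mp hx
  exact Finset.sum_pos' (fun _ _ => sq_nonneg _) ⟨i, Finset.mem_univ i, by positivity⟩

lemma ae_sqNorm_pos_stdComplexGaussianVec [Nonempty ι] :
    ∀ᵐ x ∂stdComplexGaussianVec ι, 0 < sqNorm x :=
  (Measure.ae_ne _ 0).mono fun _ => sqNorm_pos

lemma sqNorm_smul (c : ℝ) (x : ι → ℂ) : sqNorm (c • x) = c ^ 2 * sqNorm x := by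
  simp [sqNorm, mul_pow, Finset.mul_sum]

lemma ofReal_sqNorm (x : ι → ℂ) : (sqNorm x : ℂ) = star x ⬝ᵥ x := by
  simp [sqNorm, dotProduct, Complex.conj_mul']

lemma sqNorm_mulVec_of_conjTranspose_mul_eq [Fintype κ] {V : Matrix κ ι ℂ} {W : Matrix κ' ι ℂ}
    (h : Vᴴ * V = Wᴴ * W) (x : ι → ℂ) : sqNorm (V *ᵥ x) = sqNorm (W *ᵥ x) := by
  rw [← Complex.ofReal_inj, ofReal_sqNorm, ofReal_sqNorm, star_mulVec, star_mulVec,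
    ← dotProduct_mulVec, ← dotProduct_mulVec, mulVec_mulVec, mulVec_mulVec, h]

end Vector

lemma inv_ofReal_eq_lintegral_exp {r : ℝ} (hr : 0 ≤ r) :
    (ENNReal.ofReal r)⁻¹ = ∫⁻ t in Set.Ioi (0 : ℝ), ENNReal.ofReal (Real.exp (-t * r)) := by
  rcases hr.eq_or_lt with rfl | hr
  · simp
  · simp_rw [neg_mul_comm, mul_comm _ (-r)]
    rw [← ofReal_integral_eq_lintegral_ofReal _ (.of_forall fun t => (Real.exp_pos _).le),
      integral_exp_mul_Ioi (by linarith), ← ENNReal.ofReal_inv_of_pos hr]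
    · simp
    · exact exp_neg_integrableOn_Ioi 0 hr

lemma lintegral_Ioi_inv_one_add_pow (m : ℕ) :
    ∫⁻ t in Set.Ioi (0 : ℝ), ENNReal.ofReal ((1 + t) ^ (m + 2))⁻¹
      = ENNReal.ofReal (1 / (m + 1)) := by
  have hprim : ∀ t ∈ Set.Ioi (0 : ℝ), HasDerivAt (fun t : ℝ => -((m + 1) * (1 + t) ^ (m + 1))⁻¹)
      ((1 + t) ^ (m + 2))⁻¹ t := by
    intro t ht
    have hpos : 0 < 1 + t := by linarith [Set.mem_Ioi.mp ht]
    have hderiv := ((((hasDerivAt_id t).const_add 1).pow (m + 1)).const_mul ((m : ℝ) + 1)).inv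
      (by simp only [Pi.pow_apply, id]; positivity)
    refine hderiv.neg.congr_deriv ?_
    simp only [Pi.pow_apply, id]
    push_cast
    field_simp
    ring
  have hcont :
      ContinuousWithinAt (fun t : ℝ => -((m + 1) * (1 + t) ^ (m + 1))⁻¹) (Set.Ici 0) 0 := by
    refine ((ContinuousAt.inv₀ (by fun_prop) ?_).neg).continuousWithinAt
    rw [add_zero, one_pow, mul_one]
    positivity
  have hlim : Filter.Tendsto (fun t : ℝ => -((m + 1) * (1 + t) ^ (m + 1))⁻¹) Filter.atTop
      (nhds (-0)) := by
    refine (Filter.Tendsto.inv_tendsto_atTop ?_).neg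
    refine Filter.Tendsto.const_mul_atTop (by positivity) ?_
    exact (Filter.tendsto_pow_atTop (by omega)).comp
      (Filter.tendsto_atTop_add_const_left _ 1 Filter.tendsto_id)
  have hnonneg : ∀ t ∈ Set.Ioi (0 : ℝ), 0 ≤ ((1 + t) ^ (m + 2))⁻¹ := fun t ht => by
    have := Set.mem_Ioi.mp ht
    positivity
  rw [← ofReal_integral_eq_lintegral_ofReal
    (integrableOn_Ioi_deriv_of_nonneg hcont hprim hnonneg hlim)
    ((ae_restrict_mem measurableSet_Ioi).mono hnonneg),
    integral_Ioi_of_hasDerivAt_of_nonneg hcont hprim hnonneg hlim]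
  simp

section SqNormMoments

variable {ι : Type*} [Fintype ι]

lemma lintegral_eval_stdComplexGaussianVec (i : ι) {f : ℂ → ℝ≥0∞} (hf : Measurable f) :
    ∫⁻ y, f (y i) ∂stdComplexGaussianVec ι = ∫⁻ z, f z ∂stdComplexGaussian :=
  (measurePreserving_eval (fun _ : ι => stdComplexGaussian) i).lintegral_comp hf

lemma lintegral_eval_mul_eval_stdComplexGaussianVec {i j : ι} (hij : i ≠ j)
    {f : ℂ → ℝ≥0∞} (hf : Measurable f) :
    ∫⁻ y, f (y i) * f (y j) ∂stdComplexGaussianVec ι = (∫⁻ z, f z ∂stdComplexGaussian) ^ 2 := by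
  have hindep : IndepFun (fun y : ι → ℂ => f (y i)) (fun y => f (y j)) (stdComplexGaussianVec ι) :=
    (iIndepFun_pi (μ := fun _ : ι => stdComplexGaussian) fun _ => hf.aemeasurable).indepFun hij
  have hcoord (i : ι) : AEMeasurable (fun y : ι → ℂ => f (y i)) (stdComplexGaussianVec ι) :=
    (hf.comp (measurable_pi_apply i)).aemeasurable
  rw [lintegral_mul_eq_lintegral_mul_lintegral_of_indepFun'' (hcoord i) (hcoord j) hindep,
    lintegral_eval_stdComplexGaussianVec i hf, lintegral_eval_stdComplexGaussianVec j hf, sq]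

lemma ofReal_sqNorm_eq_sum (y : ι → ℂ) :
    ENNReal.ofReal (sqNorm y) = ∑ i, ENNReal.ofReal (‖y i‖ ^ 2) :=
  ENNReal.ofReal_sum_of_nonneg fun _ _ => sq_nonneg _

lemma lintegral_norm_sq_stdComplexGaussian :
    ∫⁻ z, ENNReal.ofReal (‖z‖ ^ 2) ∂stdComplexGaussian = 1 := by
  simpa using lintegral_norm_pow_stdComplexGaussian 1

lemma hasMean_sqNorm_stdComplexGaussianVec :
    HasMean sqNorm (Fintype.card ι) (stdComplexGaussianVec ι) := by
  refine hasMean_of_lintegral_ofReal_eq (by fun_prop) (.of_forall sqNorm_nonneg)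
    (Nat.cast_nonneg _) ?_
  simp_rw [ofReal_sqNorm_eq_sum]
  rw [lintegral_finsetSum _ (by fun_prop)]
  simp_rw [fun i : ι => lintegral_eval_stdComplexGaussianVec i
    (f := fun z => ENNReal.ofReal (‖z‖ ^ 2)) (by fun_prop), lintegral_norm_sq_stdComplexGaussian]
  simp

lemma lintegral_norm_sq_mul_norm_sq_stdComplexGaussianVec [DecidableEq ι] (i j : ι) :
    ∫⁻ y, ENNReal.ofReal (‖y i‖ ^ 2) * ENNReal.ofReal (‖y j‖ ^ 2) ∂stdComplexGaussianVec ι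
      = if i = j then 2 else 1 := by
  split_ifs with hij
  · subst hij
    rw [lintegral_eval_stdComplexGaussianVec i
      (f := fun z => ENNReal.ofReal (‖z‖ ^ 2) * ENNReal.ofReal (‖z‖ ^ 2)) (by fun_prop)]
    simp_rw [← ENNReal.ofReal_mul (sq_nonneg _), ← pow_add]
    simpa using lintegral_norm_pow_stdComplexGaussian 2
  · rw [lintegral_eval_mul_eval_stdComplexGaussianVec hij
      (f := fun z => ENNReal.ofReal (‖z‖ ^ 2)) (by fun_prop), lintegral_norm_sq_stdComplexGaussian,
      one_pow]

lemma hasMean_sqNorm_sq_stdComplexGaussianVec :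
    HasMean (fun y => sqNorm y ^ 2) (Fintype.card ι * (Fintype.card ι + 1))
      (stdComplexGaussianVec ι) := by
  classical
  refine hasMean_of_lintegral_ofReal_eq (by fun_prop) (.of_forall fun y => by positivity)
    (by positivity) ?_
  simp_rw [fun y : ι → ℂ => ENNReal.ofReal_pow (sqNorm_nonneg y) 2, ofReal_sqNorm_eq_sum, sq,
    Finset.sum_mul_sum]
  rw [lintegral_finsetSum _ (by fun_prop)]
  simp_rw [fun i : ι => lintegral_finsetSum Finset.univ (μ := stdComplexGaussianVec ι)
    (f := fun j y => ENNReal.ofReal (‖y i‖ * ‖y i‖) * ENNReal.ofReal (‖y j‖ * ‖y j‖))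
    (by fun_prop), ← sq, lintegral_norm_sq_mul_norm_sq_stdComplexGaussianVec]
  have hrow (i : ι) : (∑ j, if i = j then (2 : ℝ≥0∞) else 1) = Fintype.card ι + 1 := by
    have hij (j : ι) : (if i = j then (2 : ℝ≥0∞) else 1) = 1 + if i = j then 1 else 0 := by
      split_ifs <;> norm_num
    simp [hij, Finset.sum_add_distrib]
  simp_rw [hrow, Finset.sum_const, nsmul_eq_mul]
  rw [ENNReal.ofReal_mul (by positivity), ENNReal.ofReal_add (by positivity) zero_le_one]
  simp

lemma lintegral_exp_neg_mul_sqNorm_stdComplexGaussianVec {t : ℝ} (ht : 0 ≤ t) :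
    ∫⁻ y, ENNReal.ofReal (Real.exp (-t * sqNorm y)) ∂stdComplexGaussianVec ι
      = ENNReal.ofReal ((1 + t) ^ Fintype.card ι)⁻¹ := by
  have hcoord : ∫⁻ z, ENNReal.ofReal (Real.exp (-t * ‖z‖ ^ 2)) ∂stdComplexGaussian
      = ENNReal.ofReal (1 + t)⁻¹ := by
    simpa using lintegral_norm_pow_mul_exp_stdComplexGaussian 0 ht
  have hprod (y : ι → ℂ) : ENNReal.ofReal (Real.exp (-t * sqNorm y))
      = ∏ i, ENNReal.ofReal (Real.exp (-t * ‖y i‖ ^ 2)) := by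
    rw [← ENNReal.ofReal_prod_of_nonneg fun i _ => (Real.exp_pos _).le, sqNorm, Finset.mul_sum,
      Real.exp_sum]
  have hindep := iIndepFun_pi (μ := fun _ : ι => stdComplexGaussian)
    (X := fun _ z => ENNReal.ofReal (Real.exp (-t * ‖z‖ ^ 2))) (fun _ => by fun_prop)
  simp_rw [hprod]
  rw [lintegral_prod_eq_prod_lintegral_of_indepFun _ _ hindep (by fun_prop)]
  simp_rw [fun i : ι => lintegral_eval_stdComplexGaussianVec i
    (f := fun z => ENNReal.ofReal (Real.exp (-t * ‖z‖ ^ 2))) (by fun_prop), hcoord]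
  rw [Finset.prod_const, ← ENNReal.ofReal_pow (by positivity), inv_pow, Finset.card_univ]

lemma lintegral_inv_sqNorm_stdComplexGaussianVec {m : ℕ} (hm : Fintype.card ι = m + 2) :
    ∫⁻ y, (ENNReal.ofReal (sqNorm y))⁻¹ ∂stdComplexGaussianVec ι
      = ENNReal.ofReal (1 / (m + 1)) := by
  simp_rw [fun y : ι → ℂ => inv_ofReal_eq_lintegral_exp (sqNorm_nonneg y)]
  rw [lintegral_lintegral_swap (by fun_prop), ← lintegral_Ioi_inv_one_add_pow m]
  refine setLIntegral_congr_fun measurableSet_Ioi fun t ht => ?_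
  rw [← hm]
  exact lintegral_exp_neg_mul_sqNorm_stdComplexGaussianVec (Set.mem_Ioi.mp ht).le

lemma hasMean_inv_sqNorm_stdComplexGaussianVec {m : ℕ} (hm : Fintype.card ι = m + 2) :
    HasMean (fun y => (sqNorm y)⁻¹) (1 / (m + 1)) (stdComplexGaussianVec ι) := by
  refine hasMean_of_lintegral_ofReal_eq (by fun_prop)
    (.of_forall fun y => inv_nonneg.mpr (sqNorm_nonneg y)) (by positivity) ?_
  rw [← lintegral_inv_sqNorm_stdComplexGaussianVec hm]
  refine lintegral_congr_ae ?_
  have : Nonempty ι := Fintype.card_pos_iff.mp (by omega)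
  filter_upwards [ae_sqNorm_pos_stdComplexGaussianVec (ι := ι)] with y hy
  exact ENNReal.ofReal_inv_of_pos hy

end SqNormMoments

section StarProjection

variable {ι : Type*} [Fintype ι] {B : Matrix ι ι ℂ}

lemma isHermitian_of_isStarProjection (hB : IsStarProjection B) : B.IsHermitian :=
  hB.isSelfAdjoint

lemma ofReal_sqNorm_mulVec_of_isStarProjection (hB : IsStarProjection B) (x : ι → ℂ) :
    (sqNorm (B *ᵥ x) : ℂ) = star x ⬝ᵥ B *ᵥ x := by
  rw [ofReal_sqNorm, star_mulVec, (isHermitian_of_isStarProjection hB).eq, ← dotProduct_mulVec,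
    mulVec_mulVec, hB.isIdempotentElem.eq]

lemma eigenvalues_eq_zero_or_one_of_isStarProjection [DecidableEq ι] (hB : IsStarProjection B)
    (i : ι) :
    (isHermitian_of_isStarProjection hB).eigenvalues i = 0 ∨
      (isHermitian_of_isStarProjection hB).eigenvalues i = 1 :=
  hB.isIdempotentElem.spectrum_subset ℝ
    ((isHermitian_of_isStarProjection hB).eigenvalues_mem_spectrum_real i)

lemma exists_mul_conjTranspose_eq_one_of_isStarProjection (hB : IsStarProjection B) {n : ℕ}
    (hn : B.trace = n) : ∃ V : Matrix (Fin n) ι ℂ, V * Vᴴ = 1 ∧ Vᴴ * V = B := by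
  classical
  have hB' := isHermitian_of_isStarProjection hB
  set U : Matrix ι ι ℂ := (hB'.eigenvectorUnitary : Matrix ι ι ℂ)
  set W : Matrix {i // hB'.eigenvalues i = 1} ι ℂ := Uᴴ.submatrix Subtype.val id with hW
  have hWW : W * Wᴴ = 1 := by
    rw [hW, conjTranspose_submatrix, conjTranspose_conjTranspose,
      ← submatrix_mul _ _ _ _ _ Function.bijective_id, ← star_eq_conjTranspose,
      Unitary.coe_star_mul_self, submatrix_one _ Subtype.val_injective]
  have hWB : Wᴴ * W = B := by
    have hspec : B = U * diagonal (fun i => (hB'.eigenvalues i : ℂ)) * Uᴴ := by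
      conv_lhs => rw [hB'.spectral_theorem, Unitary.conjStarAlgAut_apply]
      rfl
    ext a b
    calc (Wᴴ * W) a b = ∑ i : {i // hB'.eigenvalues i = 1}, U a i * Uᴴ i b := by
          simp only [hW, Matrix.mul_apply, conjTranspose_apply, submatrix_apply, star_star, id]
      _ = ∑ i, if hB'.eigenvalues i = 1 then U a i * Uᴴ i b else 0 := by
          rw [← Finset.sum_filter, Finset.sum_subtype _ fun i => Finset.mem_filter_univ i]
      _ = ∑ i, U a i * hB'.eigenvalues i * Uᴴ i b := Finset.sum_congr rfl fun i _ => by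
          rcases eigenvalues_eq_zero_or_one_of_isStarProjection hB i with hi | hi <;> simp [hi]
      _ = B a b := by
          rw [congrFun₂ hspec a b, Matrix.mul_apply]
          simp only [mul_diagonal]
  have hcard : Fintype.card {i // hB'.eigenvalues i = 1} = n := by
    have htrace := congrArg trace hWW
    rw [trace_mul_comm, hWB, hn, trace_one] at htrace
    exact_mod_cast htrace.symm
  set e := Fintype.equivFinOfCardEq hcard
  refine ⟨W.submatrix e.symm id, ?_, ?_⟩
  · rw [conjTranspose_submatrix, ← submatrix_mul _ _ _ _ _ Function.bijective_id, hWW,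
      submatrix_one_equiv]
  · rw [conjTranspose_submatrix, submatrix_mul_equiv, hWB, submatrix_id_id]

lemma map_sqNorm_mulVec_of_isStarProjection (hB : IsStarProjection B) {n : ℕ} (hn : B.trace = n) :
    (stdComplexGaussianVec ι).map (fun x => sqNorm (B *ᵥ x))
      = (stdComplexGaussianVec (Fin n)).map sqNorm := by
  obtain ⟨V, hVV, hVB⟩ := exists_mul_conjTranspose_eq_one_of_isStarProjection hB hn
  have hsqNorm : (fun x => sqNorm (B *ᵥ x)) = sqNorm ∘ fun x => V *ᵥ x := by
    funext x
    refine sqNorm_mulVec_of_conjTranspose_mul_eq ?_ x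
    rw [(isHermitian_of_isStarProjection hB).eq, hB.isIdempotentElem.eq, hVB]
  rw [hsqNorm, ← Measure.map_map measurable_sqNorm (measurable_mulVec V),
    map_mulVec_eq_of_mul_conjTranspose_eq_one hVV]

end StarProjection

section OrthProj

variable {m ι κ : Type*} [Fintype ι]

/-- Matrix whose columns are the vectors `H i`. -/
def colMatrix (H : ι → m → ℂ) : Matrix m ι ℂ := Matrix.of fun a i => H i a

lemma colMatrix_mulVec (H : ι → m → ℂ) (c : ι → ℂ) : colMatrix H *ᵥ c = ∑ i, c i • H i := by
  ext a
  simp [colMatrix, mulVec, dotProduct, mul_comm]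

variable [Fintype m] [DecidableEq ι]

open scoped ComplexOrder in
lemma isUnit_det_gram {H : ι → m → ℂ} (hH : LinearIndependent ℂ H) :
    IsUnit ((colMatrix H)ᴴ * colMatrix H).det := by
  rw [← isUnit_iff_isUnit_det]
  exact (PosDef.conjTranspose_mul_self _ (mulVec_injective_iff.mpr hH)).isUnit

/-- The dual basis of linearly independent vectors `H i` in their span, given by the columns of
the pseudo-inverse. -/
def dualVector (H : ι → m → ℂ) (i : ι) : m → ℂ :=
  (colMatrix H * ((colMatrix H)ᴴ * colMatrix H)⁻¹) *ᵥ Pi.single i 1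

lemma exists_dualVector_eq_sum (H : ι → m → ℂ) (i : ι) :
    ∃ c : ι → ℂ, dualVector H i = ∑ j, c j • H j := by
  rw [dualVector, ← mulVec_mulVec]
  exact ⟨_, colMatrix_mulVec H _⟩

lemma star_dotProduct_dualVector {H : ι → m → ℂ} (hH : LinearIndependent ℂ H) (i j : ι) :
    star (H i) ⬝ᵥ dualVector H j = if i = j then 1 else 0 := by
  change ((colMatrix H)ᴴ *ᵥ dualVector H j) i = _
  rw [dualVector, mulVec_mulVec, ← Matrix.mul_assoc,
    mul_nonsing_inv _ (isUnit_det_gram hH), one_mulVec, Pi.single_apply]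

variable [DecidableEq m]

/-- Orthogonal projection onto the orthogonal complement of the span of linearly independent
vectors `H i`. It is the identity matrix if the Gram matrix is singular, since its inverse is
then `0`. -/
def orthProj (H : ι → m → ℂ) : Matrix m m ℂ :=
  1 - colMatrix H * ((colMatrix H)ᴴ * colMatrix H)⁻¹ * (colMatrix H)ᴴ

lemma isStarProjection_orthProj (H : ι → m → ℂ) : IsStarProjection (orthProj H) := by
  set G := (colMatrix H)ᴴ * colMatrix H with hG
  have hinv : G⁻¹ * G * G⁻¹ = G⁻¹ := by
    by_cases hu : IsUnit G.det
    · rw [nonsing_inv_mul _ hu, Matrix.one_mul]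
    · rw [nonsing_inv_apply_not_isUnit _ hu, Matrix.mul_zero]
  refine IsStarProjection.one_sub ⟨?_, ?_⟩
  · calc colMatrix H * G⁻¹ * (colMatrix H)ᴴ * (colMatrix H * G⁻¹ * (colMatrix H)ᴴ)
        = colMatrix H * (G⁻¹ * G * G⁻¹) * (colMatrix H)ᴴ := by
          simp only [hG, Matrix.mul_assoc]
      _ = colMatrix H * G⁻¹ * (colMatrix H)ᴴ := by rw [hinv]
  · exact isHermitian_mul_mul_conjTranspose _ (isHermitian_conjTranspose_mul_self _).inv

lemma trace_orthProj {H : ι → m → ℂ} (hH : LinearIndependent ℂ H) {n : ℕ}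
    (hn : Fintype.card ι + n = Fintype.card m) : (orthProj H).trace = n := by
  rw [orthProj, trace_sub, trace_one, Matrix.mul_assoc, trace_mul_comm, Matrix.mul_assoc,
    nonsing_inv_mul _ (isUnit_det_gram hH), trace_one, ← hn]
  push_cast
  ring

lemma orthProj_mulVec_self {H : ι → m → ℂ} (hH : LinearIndependent ℂ H) (i : ι) :
    orthProj H *ᵥ H i = 0 := by
  have hcol : H i = colMatrix H *ᵥ Pi.single i 1 := by
    rw [mulVec_single_one]
    rfl
  rw [hcol, mulVec_mulVec, orthProj, Matrix.sub_mul, Matrix.one_mul, Matrix.mul_assoc,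
    Matrix.mul_assoc, nonsing_inv_mul _ (isUnit_det_gram hH), Matrix.mul_one, sub_self, zero_mulVec]

lemma orthProj_mulVec (H : ι → m → ℂ) (x : m → ℂ) :
    orthProj H *ᵥ x = x - ∑ i, (star (H i) ⬝ᵥ x) • dualVector H i := by
  rw [orthProj, sub_mulVec, one_mulVec, ← mulVec_mulVec, mulVec_eq_sum]
  simp only [dualVector, mulVec_single_one, op_smul_eq_smul]
  rfl

lemma orthProj_mulVec_eq_self {H : ι → m → ℂ} {x : m → ℂ} (hx : ∀ i, star (H i) ⬝ᵥ x = 0) :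
    orthProj H *ᵥ x = x := by
  simp [orthProj_mulVec, hx]

lemma star_dotProduct_orthProj_mulVec {H : ι → m → ℂ} (hH : LinearIndependent ℂ H) (i : ι)
    (x : m → ℂ) : star (H i) ⬝ᵥ orthProj H *ᵥ x = 0 := by
  have h := congrArg star (orthProj_mulVec_self hH i)
  rw [star_mulVec, (isHermitian_of_isStarProjection (isStarProjection_orthProj H)).eq,
    star_zero] at h
  rw [dotProduct_mulVec, h, zero_dotProduct]

variable [DecidableEq κ]

/-- The dual vector of `k` is the component of `H k` orthogonal to the other vectors, rescaled to
have inner product `1` with `H k`. -/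
lemma sqNorm_dualVector {H : κ → m → ℂ} {S : Finset κ} (hH : LinearIndepOn ℂ H (S : Set κ)) {k : κ}
    (hk : k ∈ S) :
    sqNorm (dualVector (fun i : S => H i) ⟨k, hk⟩)
      = (sqNorm (orthProj (fun i : S.erase k => H i) *ᵥ H k))⁻¹ := by
  set B := orthProj fun i : S.erase k => H i
  set u := dualVector (fun i : S => H i) ⟨k, hk⟩
  set q := sqNorm (B *ᵥ H k)
  have hproj : IsStarProjection B := isStarProjection_orthProj _
  have hdual (i : S) : star (H i) ⬝ᵥ u = if i = ⟨k, hk⟩ then 1 else 0 :=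
    star_dotProduct_dualVector hH i ⟨k, hk⟩
  have hBH (i : S) (hi : i ≠ ⟨k, hk⟩) : B *ᵥ H i = 0 :=
    orthProj_mulVec_self (hH.mono (Finset.coe_subset.mpr (S.erase_subset k)))
      ⟨i, Finset.mem_erase.mpr ⟨fun h => hi (Subtype.ext h), i.2⟩⟩
  have hBu : B *ᵥ u = u := orthProj_mulVec_eq_self fun i => by
    rw [hdual ⟨i, Finset.mem_of_mem_erase i.2⟩,
      if_neg fun h => Finset.ne_of_mem_erase i.2 (congrArg Subtype.val h)]
  obtain ⟨c, hu⟩ : ∃ c : ℂ, u = c • B *ᵥ H k := by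
    obtain ⟨c, hc⟩ := exists_dualVector_eq_sum (fun i : S => H i) ⟨k, hk⟩
    refine ⟨c ⟨k, hk⟩, ?_⟩
    rw [← hBu, show u = _ from hc, mulVec_sum]
    simp_rw [mulVec_smul]
    exact Fintype.sum_eq_single _ fun i hi => by rw [hBH i hi, smul_zero]
  have hcq : c * q = 1 := by
    rw [ofReal_sqNorm_mulVec_of_isStarProjection hproj, ← smul_eq_mul, ← dotProduct_smul, ← hu,
      hdual ⟨k, hk⟩, if_pos rfl]
  have hc : c = ((q⁻¹ : ℝ) : ℂ) := by
    rw [Complex.ofReal_inv]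
    exact eq_inv_of_mul_eq_one_left hcq
  rw [hu, hc, Complex.coe_smul, sqNorm_smul, sq, mul_assoc]
  have hq : q ≠ 0 := fun h => by simp [h] at hcq
  rw [inv_mul_cancel₀ hq, mul_one]

end OrthProj

section Precoder

variable {m ι κ : Type*} [Fintype m] [Fintype ι] [DecidableEq ι]

lemma measurable_inv_gram_apply (i j : ι) :
    Measurable fun H : ι → m → ℂ => ((colMatrix H)ᴴ * colMatrix H)⁻¹ i j := by
  have hcol : Continuous fun H : ι → m → ℂ => colMatrix H :=
    continuous_matrix fun a i => (by fun_prop : Continuous fun H : ι → m → ℂ => H i a)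
  have hgram := hcol.matrix_conjTranspose.matrix_mul hcol
  simp_rw [inv_def, Ring.inverse_eq_inv', Matrix.smul_apply, smul_eq_mul]
  exact hgram.matrix_det.measurable.inv.mul (hgram.matrix_adjugate.matrix_elem i j).measurable

lemma measurable_dualVector (i : ι) : Measurable fun H : ι → m → ℂ => dualVector H i := by
  simp_rw [dualVector, ← mulVec_mulVec, colMatrix_mulVec, mulVec_single_one, col_apply]
  exact Finset.measurable_fun_sum _ fun j _ =>
    (measurable_inv_gram_apply j i).smul (measurable_pi_apply j)

variable [DecidableEq m] [DecidableEq κ]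

lemma measurable_orthProj_mulVec :
    Measurable fun p : (ι → m → ℂ) × (m → ℂ) => orthProj p.1 *ᵥ p.2 := by
  simp_rw [orthProj_mulVec, dotProduct]
  refine measurable_snd.sub (Finset.measurable_fun_sum _ fun i _ => Measurable.fun_smul ?_
    ((measurable_dualVector i).comp measurable_fst))
  simp only [Pi.star_apply]
  fun_prop

/-- Partial zero-forcing precoder before normalization, for estimated channels `H` of which those
in `S` are protected: zero-forcing for `k ∈ S`, and for `k ∉ S` maximum-ratio transmission projected
onto the orthogonal complement of the estimates in `S`. -/
def precoder (S : Finset κ) (H : κ → m → ℂ) (k : κ) : m → ℂ :=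
  if hk : k ∈ S then dualVector (fun i : S => H i) ⟨k, hk⟩
  else orthProj (fun i : S => H i) *ᵥ H k

lemma measurable_precoder (S : Finset κ) (k : κ) :
    Measurable fun H : κ → m → ℂ => precoder S H k := by
  have hrestrict : Measurable fun (H : κ → m → ℂ) (i : S) => H i :=
    measurable_pi_lambda _ fun i => measurable_pi_apply _
  by_cases hk : k ∈ S
  · simp only [precoder, hk, dite_true]
    exact (measurable_dualVector _).comp hrestrict
  · have hcomp : (fun H : κ → m → ℂ => precoder S H k)
        = (fun p : (S → m → ℂ) × (m → ℂ) => orthProj p.1 *ᵥ p.2) ∘ fun H => (fun i => H i, H k) :=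
      funext fun H => dif_neg hk
    rw [hcomp]
    exact measurable_orthProj_mulVec.comp (hrestrict.prodMk (measurable_pi_apply k))

lemma precoder_congr {S : Finset κ} {H H' : κ → m → ℂ} {k : κ} (hS : ∀ i ∈ S, H i = H' i)
    (hk : H k = H' k) : precoder S H k = precoder S H' k := by
  have h : (fun i : S => H i) = fun i : S => H' i := funext fun i => hS i i.2
  rw [precoder, precoder, h, hk]

variable {S : Finset κ} {H : κ → m → ℂ} {i k : κ}

lemma star_dotProduct_precoder_of_mem (hH : LinearIndepOn ℂ H (S : Set κ)) (hi : i ∈ S) :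
    star (H i) ⬝ᵥ precoder S H k = if k = i then 1 else 0 := by
  by_cases hk : k ∈ S
  · rw [precoder, dif_pos hk]
    refine (star_dotProduct_dualVector (H := fun j : S => H j) hH ⟨i, hi⟩ ⟨k, hk⟩).trans ?_
    simp only [Subtype.mk.injEq, eq_comm]
  · rw [precoder, dif_neg hk, if_neg (ne_of_mem_of_not_mem hi hk).symm]
    exact star_dotProduct_orthProj_mulVec (H := fun j : S => H j) hH ⟨i, hi⟩ _

lemma star_dotProduct_precoder_of_notMem (hk : k ∉ S) :
    star (H k) ⬝ᵥ precoder S H k = sqNorm (orthProj (fun i : S => H i) *ᵥ H k) := by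
  rw [precoder, dif_neg hk, ofReal_sqNorm_mulVec_of_isStarProjection (isStarProjection_orthProj _)]

end Precoder

section IndepGaussian

variable {Ω : Type*} [MeasurableSpace Ω] {μ : Measure Ω} [IsProbabilityMeasure μ]

lemma map_eq_of_indepFun_of_forall_map_eq {α δ ε : Type*} [MeasurableSpace α] [MeasurableSpace δ]
    [MeasurableSpace ε] {X : Ω → α} {Y : Ω → δ} {f : α × δ → ε} {ν : Measure ε}
    (hX : Measurable X) (hY : Measurable Y) (hXY : IndepFun X Y μ) (hf : Measurable f)
    (h : ∀ᵐ ω ∂μ, (μ.map Y).map (fun y => f (X ω, y)) = ν) :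
    μ.map (fun ω => f (X ω, Y ω)) = ν := by
  have hjoint : μ.map (fun ω => f (X ω, Y ω)) = ((μ.map X).prod (μ.map Y)).map f := by
    rw [← (indepFun_iff_map_prod_eq_prod_map_map hX.aemeasurable hY.aemeasurable).mp hXY,
      Measure.map_map hf (hX.prodMk hY)]
    rfl
  ext s hs
  rw [hjoint, Measure.map_apply hf hs, Measure.prod_apply (hf hs),
    lintegral_map (measurable_measure_prodMk_left (hf hs)) hX]
  calc ∫⁻ ω, μ.map Y (Prod.mk (X ω) ⁻¹' (f ⁻¹' s)) ∂μ
      = ∫⁻ _, ν s ∂μ := lintegral_congr_ae <| h.mono fun ω hω => by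
        exact (Measure.map_apply (hf.comp measurable_prodMk_left) hs).symm.trans
          (DFunLike.congr_fun hω s)
    _ = ν s := by simp

variable {m κ : Type*} [Fintype m]

/-- The vectors `H i` are independent, and the coordinates of `H i` are independent complex
Gaussian variables of variance `σ i ^ 2`. -/
structure IsIndepGaussian (H : κ → Ω → m → ℂ) (σ : κ → ℝ) (μ : Measure Ω) : Prop where
  measurable : ∀ i, Measurable (H i)
  indep : iIndepFun H μ
  law : ∀ i, μ.map (H i) = (stdComplexGaussianVec m).map fun x => σ i • x

lemma map_curry_stdComplexGaussianVec [Fintype κ] :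
    (stdComplexGaussianVec (κ × m)).map (fun x i a => x (i, a))
      = Measure.pi fun _ : κ => stdComplexGaussianVec m := by
  have h := Measure.infinitePi_map_curry fun (_ : κ) (_ : m) => stdComplexGaussian
  simp_rw [Measure.infinitePi_eq_pi] at h
  exact h

variable {s : Type*} [Fintype s] [DecidableEq κ] {R : Matrix κ s ℂ} {σ : κ → ℝ}

lemma map_sum_mul_stdComplexGaussianVec [Fintype κ]
    (hR : R * Rᴴ = diagonal fun i => (σ i : ℂ) ^ 2) :
    (stdComplexGaussianVec (s × m)).map (fun x i a => ∑ j, R i j * x (j, a))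
      = Measure.pi fun i => (stdComplexGaussianVec m).map fun x => σ i • x := by
  classical
  set V := kroneckerMap (· * ·) R (1 : Matrix m m ℂ) with hV
  set D : Matrix (κ × m) (κ × m) ℂ := diagonal fun p => (σ p.1 : ℂ)
  have hVD : V * Vᴴ = D * Dᴴ := by
    rw [hV, conjTranspose_kronecker, ← mul_kronecker_mul, hR, conjTranspose_one, Matrix.one_mul,
      ← diagonal_one, diagonal_kronecker_diagonal, diagonal_conjTranspose, diagonal_mul_diagonal]
    congr 1
    ext p
    simp [sq]
  have hrows : (fun (x : s × m → ℂ) (i : κ) a => ∑ j, R i j * x (j, a))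
      = (fun x i a => x (i, a)) ∘ fun x => V *ᵥ x := by
    funext x i a
    simp [V, mulVec, dotProduct, Fintype.sum_prod_type, one_apply]
  have hscale : (fun (x : κ × m → ℂ) (i : κ) (a : m) => x (i, a)) ∘ (fun x => D *ᵥ x)
      = (fun y i => σ i • y i) ∘ fun x i a => x (i, a) := by
    funext x i a
    simp [D, mulVec_diagonal]
  rw [hrows, ← Measure.map_map (by fun_prop) (by fun_prop),
    map_mulVec_eq_of_mul_conjTranspose_eq hVD, Measure.map_map (by fun_prop) (by fun_prop), hscale,
    ← Measure.map_map (by fun_prop) (by fun_prop), map_curry_stdComplexGaussianVec]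
  exact Measure.pi_map_pi fun i => by fun_prop

lemma isIndepGaussian_of_mul_conjTranspose_eq [Finite κ] {G : Ω → s × m → ℂ} (hG : Measurable G)
    (hlaw : μ.map G = stdComplexGaussianVec (s × m))
    (hR : R * Rᴴ = diagonal fun i => (σ i : ℂ) ^ 2) :
    IsIndepGaussian (fun i ω a => ∑ j, R i j * G ω (j, a)) σ μ := by
  have := Fintype.ofFinite κ
  set H : κ → Ω → m → ℂ := fun i ω a => ∑ j, R i j * G ω (j, a)
  set ν : κ → Measure (m → ℂ) := fun i => (stdComplexGaussianVec m).map fun x => σ i • x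
  have hH (i : κ) : Measurable (H i) := by fun_prop
  have (i : κ) : IsProbabilityMeasure (ν i) := Measure.isProbabilityMeasure_map (by fun_prop)
  have hjoint : μ.map (fun ω i => H i ω) = Measure.pi ν := by
    rw [← map_sum_mul_stdComplexGaussianVec hR, ← hlaw, Measure.map_map (by fun_prop) hG]
    rfl
  have hmarginal (i : κ) : μ.map (H i) = ν i := by
    rw [← (measurePreserving_eval ν i).map_eq, ← hjoint,
      Measure.map_map (by fun_prop) (by fun_prop)]
    rfl
  refine ⟨hH, ?_, hmarginal⟩
  rw [iIndepFun_iff_map_fun_eq_pi_map fun i => (hH i).aemeasurable, hjoint]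
  simp_rw [hmarginal]

end IndepGaussian

section SecondMoments

variable {Ω ι : Type*} [MeasurableSpace Ω] {μ : Measure Ω}

lemma integrable_mul_star {f g : Ω → ℂ} (hf : MemLp f 2 μ) (hg : MemLp g 2 μ) :
    Integrable (fun ω => f ω * star (g ω)) μ :=
  hf.integrable_mul hg.star

lemma ofReal_integral_norm_sq (f : Ω → ℂ) :
    ((∫ ω, ‖f ω‖ ^ 2 ∂μ : ℝ) : ℂ) = ∫ ω, f ω * star (f ω) ∂μ := by
  simp_rw [Complex.star_def, Complex.mul_conj', ← Complex.ofReal_pow, integral_complex_ofReal]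

lemma integral_norm_sum_sq {b : ι → Ω → ℂ} (s : Finset ι) (hb : ∀ i ∈ s, MemLp (b i) 2 μ)
    (horth : ∀ i ∈ s, ∀ j ∈ s, i ≠ j → ∫ ω, b i ω * star (b j ω) ∂μ = 0) :
    ∫ ω, ‖∑ i ∈ s, b i ω‖ ^ 2 ∂μ = ∑ i ∈ s, ∫ ω, ‖b i ω‖ ^ 2 ∂μ := by
  have hint (i) (hi : i ∈ s) (j) (hj : j ∈ s) := integrable_mul_star (hb i hi) (hb j hj)
  rw [← Complex.ofReal_inj, Complex.ofReal_sum]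
  simp_rw [ofReal_integral_norm_sq, star_sum, Finset.sum_mul_sum]
  rw [integral_finsetSum _ fun i hi => integrable_finsetSum _ (hint i hi)]
  refine Finset.sum_congr rfl fun i hi => ?_
  rw [integral_finsetSum _ (hint i hi),
    Finset.sum_eq_single i (fun j hj hij => horth i hi j hj hij.symm) (absurd hi)]

lemma integral_norm_add_sq {f g : Ω → ℂ} (hf : MemLp f 2 μ) (hg : MemLp g 2 μ)
    (horth : ∫ ω, f ω * star (g ω) ∂μ = 0) :
    ∫ ω, ‖f ω + g ω‖ ^ 2 ∂μ = (∫ ω, ‖f ω‖ ^ 2 ∂μ) + ∫ ω, ‖g ω‖ ^ 2 ∂μ := by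
  have horth' : ∫ ω, g ω * star (f ω) ∂μ = 0 := by
    have h := integral_conj (μ := μ) (f := fun ω => f ω * star (g ω))
    rw [horth, map_zero] at h
    simpa [mul_comm] using h
  have h := integral_norm_sum_sq (μ := μ) (b := ![f, g]) Finset.univ
    (by intro i _; fin_cases i <;> simpa)
    (by intro i _ j _ hij; fin_cases i <;> fin_cases j <;> simp_all)
  simpa using h

lemma memLp_two_mul_of_indepFun {f g : Ω → ℂ} (h : IndepFun f g μ) (hf : MemLp f 2 μ)
    (hg : MemLp g 2 μ) : MemLp (fun ω => f ω * g ω) 2 μ := by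
  have hnorm : IndepFun (fun ω => ‖f ω‖ ^ 2) (fun ω => ‖g ω‖ ^ 2) μ :=
    h.comp (φ := fun z : ℂ => ‖z‖ ^ 2) (ψ := fun z : ℂ => ‖z‖ ^ 2) (by fun_prop) (by fun_prop)
  refine (memLp_two_iff_integrable_sq_norm (hf.1.mul hg.1)).mpr ?_
  exact (hnorm.integrable_mul ((memLp_two_iff_integrable_sq_norm hf.1).mp hf)
    ((memLp_two_iff_integrable_sq_norm hg.1).mp hg)).congr (.of_forall fun ω => by simp [mul_pow])

lemma integral_mul_star_of_indepFun {f g : Ω → ℂ} (h : IndepFun f g μ) (hf : MemLp f 2 μ)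
    (hg : MemLp g 2 μ) (hmean : ∫ ω, f ω ∂μ = 0) : ∫ ω, f ω * star (g ω) ∂μ = 0 := by
  have hstar : IndepFun f (fun ω => star (g ω)) μ :=
    h.comp (φ := id) (ψ := fun z : ℂ => star z) measurable_id (by fun_prop)
  rw [hstar.integral_fun_mul_eq_mul_integral hf.1 hg.star.1, hmean, zero_mul]

section HasMeanVariance

variable [IsProbabilityMeasure μ] {f : Ω → ℂ} {a : ℂ} {v : ℝ}

lemma integral_norm_sq_eq_add (hf : MemLp f 2 μ) (ha : ∫ ω, f ω ∂μ = a) :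
    ∫ ω, ‖f ω‖ ^ 2 ∂μ = (∫ ω, ‖f ω - a‖ ^ 2 ∂μ) + ‖a‖ ^ 2 := by
  have hcentered : ∫ ω, (f ω - a) * star a ∂μ = 0 := by
    rw [integral_mul_const, integral_sub (hf.integrable one_le_two) (integrable_const a), ha]
    simp
  simpa using integral_norm_add_sq (hf.sub (memLp_const a)) (memLp_const a) hcentered

lemma HasMeanVariance.integral_norm_sq (h : HasMeanVariance f a v μ) :
    ∫ ω, ‖f ω‖ ^ 2 ∂μ = v + ‖a‖ ^ 2 := by
  rw [integral_norm_sq_eq_add h.memLp h.mean, h.variance]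

lemma hasMeanVariance_const (a : ℂ) : HasMeanVariance (fun _ => a) a 0 μ :=
  ⟨memLp_const a, by simp, by simp⟩

lemma hasMeanVariance_ofReal {f : Ω → ℝ} {c : ℝ} (hf : HasMean f c μ)
    (hf2 : HasMean (fun ω => f ω ^ 2) (v + c ^ 2) μ) :
    HasMeanVariance (fun ω => (f ω : ℂ)) c v μ := by
  have hmemLp : MemLp (fun ω => (f ω : ℂ)) 2 μ :=
    ((memLp_two_iff_integrable_sq hf.integrable.1).mpr hf2.integrable).ofReal
  have hmean : ∫ ω, (f ω : ℂ) ∂μ = c := by rw [integral_complex_ofReal, hf.mean]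
  refine ⟨hmemLp, hmean, ?_⟩
  have h := integral_norm_sq_eq_add hmemLp hmean
  simp only [Complex.norm_real, Real.norm_eq_abs, sq_abs, hf2.mean] at h
  linarith

lemma HasMeanVariance.sum_of_pairwise_indepFun [Fintype ι] {b : ι → Ω → ℂ} {a : ι → ℂ} {v : ι → ℝ}
    (hb : ∀ i, HasMeanVariance (b i) (a i) (v i) μ)
    (hindep : Pairwise fun i j => IndepFun (b i) (b j) μ) :
    HasMeanVariance (fun ω => ∑ i, b i ω) (∑ i, a i) (∑ i, v i) μ where
  memLp := memLp_finsetSum _ fun i _ => (hb i).memLp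
  mean := by
    rw [integral_finsetSum _ fun i _ => (hb i).memLp.integrable one_le_two]
    exact Finset.sum_congr rfl fun i _ => (hb i).mean
  variance := by
    have hcentered (i) : MemLp (fun ω => b i ω - a i) 2 μ := (hb i).memLp.sub (memLp_const _)
    have horth (i j) (hij : i ≠ j) : ∫ ω, (b i ω - a i) * star (b j ω - a j) ∂μ = 0 := by
      refine integral_mul_star_of_indepFun ((hindep hij).comp (φ := fun z => z - a i)
        (ψ := fun z => z - a j) (by fun_prop) (by fun_prop)) (hcentered i) (hcentered j) ?_
      rw [integral_sub ((hb i).memLp.integrable one_le_two) (integrable_const _), (hb i).mean]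
      simp
    simp_rw [← Finset.sum_sub_distrib]
    rw [integral_norm_sum_sq _ (fun i _ => hcentered i) fun i _ j _ hij => horth i j hij]
    exact Finset.sum_congr rfl fun i _ => (hb i).variance

end HasMeanVariance

/-- The random variables `e i` are pairwise uncorrelated (without being centered, in general) and
have the common power `p`. -/
structure IsWhite (e : ι → Ω → ℂ) (p : ℝ) (μ : Measure Ω) : Prop where
  memLp : ∀ i, MemLp (e i) 2 μ
  power : ∀ i, ∫ ω, ‖e i ω‖ ^ 2 ∂μ = p
  uncorrelated : ∀ i j, i ≠ j → ∫ ω, e i ω * star (e j ω) ∂μ = 0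

lemma indepFun_apply_apply {e w : ι → Ω → ℂ}
    (hew : IndepFun (fun ω i => e i ω) (fun ω i => w i ω) μ) (i : ι) : IndepFun (e i) (w i) μ :=
  hew.comp (φ := fun z : ι → ℂ => z i) (ψ := fun z : ι → ℂ => z i) (by fun_prop) (by fun_prop)

namespace IsWhite

variable [Fintype ι] {e w : ι → Ω → ℂ} {p : ℝ}

lemma memLp_sum_mul (he : IsWhite e p μ) (hw : ∀ i, MemLp (w i) 2 μ)
    (hew : ∀ i, IndepFun (e i) (w i) μ) : MemLp (fun ω => ∑ i, e i ω * w i ω) 2 μ :=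
  memLp_finsetSum _ fun i _ => memLp_two_mul_of_indepFun (hew i) (he.memLp i) (hw i)

lemma integral_norm_sum_mul_sq (he : IsWhite e p μ) (hw : ∀ i, MemLp (w i) 2 μ)
    (hew : IndepFun (fun ω i => e i ω) (fun ω i => w i ω) μ) :
    ∫ ω, ‖∑ i, e i ω * w i ω‖ ^ 2 ∂μ = p * ∑ i, ∫ ω, ‖w i ω‖ ^ 2 ∂μ := by
  have hew' := indepFun_apply_apply hew
  rw [integral_norm_sum_sq _ fun i _ => memLp_two_mul_of_indepFun (hew' i) (he.memLp i) (hw i),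
    Finset.mul_sum]
  · refine Finset.sum_congr rfl fun i _ => ?_
    have hnorm : IndepFun (fun ω => ‖e i ω‖ ^ 2) (fun ω => ‖w i ω‖ ^ 2) μ :=
      (hew' i).comp (φ := fun z => ‖z‖ ^ 2) (ψ := fun z => ‖z‖ ^ 2) (by fun_prop) (by fun_prop)
    simp_rw [norm_mul, mul_pow]
    rw [hnorm.integral_fun_mul_eq_mul_integral ((he.memLp i).1.norm.pow 2) ((hw i).1.norm.pow 2),
      he.power]
  · intro i _ j _ hij
    have hprod : IndepFun (fun ω => e i ω * star (e j ω)) (fun ω => w i ω * star (w j ω)) μ :=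
      hew.comp (φ := fun z : ι → ℂ => z i * star (z j)) (ψ := fun z : ι → ℂ => z i * star (z j))
        (by fun_prop) (by fun_prop)
    simp_rw [star_mul', fun ω => mul_mul_mul_comm (e i ω) (w i ω)]
    rw [hprod.integral_fun_mul_eq_mul_integral ((he.memLp i).1.mul (he.memLp j).1.star)
      ((hw i).1.mul (hw j).1.star), he.uncorrelated i j hij, zero_mul]

lemma integral_sum_mul_mul_star (he : IsWhite e p μ) (hw : ∀ i, MemLp (w i) 2 μ)
    (hew : IndepFun (fun ω i => e i ω) (fun ω i => w i ω) μ) (i : ι) :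
    ∫ ω, (∑ j, e j ω * w j ω) * star (e i ω) ∂μ = p * ∫ ω, w i ω ∂μ := by
  have hindep (j) : IndepFun (fun ω => e j ω * star (e i ω)) (w j) μ :=
    hew.comp (φ := fun z : ι → ℂ => z j * star (z i)) (ψ := fun z : ι → ℂ => z j)
      (by fun_prop) (by fun_prop)
  have hew' := indepFun_apply_apply hew
  have hterm (j) : ∫ ω, e j ω * w j ω * star (e i ω) ∂μ
      = (∫ ω, e j ω * star (e i ω) ∂μ) * ∫ ω, w j ω ∂μ := by
    simp_rw [fun ω => mul_right_comm (e j ω) (w j ω)]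
    exact (hindep j).integral_fun_mul_eq_mul_integral ((he.memLp j).1.mul (he.memLp i).1.star)
      (hw j).1
  simp_rw [Finset.sum_mul]
  rw [integral_finsetSum _ fun j _ => integrable_mul_star
    (memLp_two_mul_of_indepFun (hew' j) (he.memLp j) (hw j)) (he.memLp i), Finset.sum_congr rfl
    fun j _ => hterm j, Finset.sum_eq_single i (fun j _ hj => by
      rw [he.uncorrelated j i hj, zero_mul]) (by simp), ← ofReal_integral_norm_sq, he.power]

lemma integral_sum_mul_mul_star_of_indepFun (he : IsWhite e p μ) (hmean : ∀ i, ∫ ω, e i ω ∂μ = 0)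
    (hw : ∀ i, MemLp (w i) 2 μ) {c : Ω → ℂ} (hc : MemLp c 2 μ)
    (hewc : IndepFun (fun ω i => e i ω) (fun ω => (fun i => w i ω, c ω)) μ) :
    ∫ ω, (∑ i, e i ω * w i ω) * star (c ω) ∂μ = 0 := by
  have hew (i) : IndepFun (e i) (w i) μ :=
    indepFun_apply_apply (hewc.comp (φ := id) measurable_id measurable_fst) i
  have hindep (i) : IndepFun (e i) (fun ω => w i ω * star (c ω)) μ :=
    hewc.comp (φ := fun z : ι → ℂ => z i) (ψ := fun z : (ι → ℂ) × ℂ => z.1 i * star z.2)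
      (by fun_prop) (by fun_prop)
  simp_rw [Finset.sum_mul]
  rw [integral_finsetSum _ fun i _ => integrable_mul_star
    (memLp_two_mul_of_indepFun (hew i) (he.memLp i) (hw i)) hc]
  refine Finset.sum_eq_zero fun i _ => ?_
  simp_rw [mul_assoc]
  rw [(hindep i).integral_fun_mul_eq_mul_integral (he.memLp i).1 ((hw i).1.mul hc.1.star), hmean,
    zero_mul]

lemma hasMeanVariance_sum_mul_add [IsProbabilityMeasure μ] (he : IsWhite e p μ)
    (hmean : ∀ i, ∫ ω, e i ω ∂μ = 0) (hw : ∀ i, MemLp (w i) 2 μ) {c : Ω → ℂ} {a : ℂ} {v : ℝ}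
    (hc : HasMeanVariance c a v μ)
    (hewc : IndepFun (fun ω i => e i ω) (fun ω => (fun i => w i ω, c ω)) μ) :
    HasMeanVariance (fun ω => ∑ i, e i ω * w i ω + c ω) a
      (p * (∑ i, ∫ ω, ‖w i ω‖ ^ 2 ∂μ) + v) μ := by
  have hew : IndepFun (fun ω i => e i ω) (fun ω i => w i ω) μ :=
    hewc.comp (φ := id) measurable_id measurable_fst
  have hsum := he.memLp_sum_mul hw (indepFun_apply_apply hew)
  have hc' : MemLp (fun ω => c ω - a) 2 μ := hc.memLp.sub (memLp_const a)
  have hcentered : ∫ ω, ∑ i, e i ω * w i ω ∂μ = 0 := by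
    simpa using he.integral_sum_mul_mul_star_of_indepFun hmean hw (memLp_const (1 : ℂ))
      (hewc.comp (φ := id) (ψ := fun z : (ι → ℂ) × ℂ => (z.1, (1 : ℂ))) (by fun_prop) (by fun_prop))
  have horth := he.integral_sum_mul_mul_star_of_indepFun hmean hw hc'
    (hewc.comp (φ := id) (ψ := fun z : (ι → ℂ) × ℂ => (z.1, z.2 - a)) (by fun_prop) (by fun_prop))
  refine ⟨hsum.add hc.memLp, ?_, ?_⟩
  · rw [integral_add (hsum.integrable one_le_two) (hc.memLp.integrable one_le_two), hcentered,
      hc.mean, zero_add]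
  · simp_rw [add_sub_assoc]
    rw [integral_norm_add_sq hsum hc' horth, he.integral_norm_sum_mul_sq hw hew, hc.variance]

end IsWhite

lemma IsWhite.of_identDistrib {Ω' α : Type*} [MeasurableSpace Ω'] [MeasurableSpace α]
    {ν : Measure Ω'} {V : Ω → α} {W : Ω' → α} {f : ι → α → ℂ} {p : ℝ} (hf : ∀ i, Measurable (f i))
    (hVW : IdentDistrib V W μ ν) (hW : IsWhite (fun i ω => f i (W ω)) p ν) :
    IsWhite (fun i ω => f i (V ω)) p μ where
  memLp i := (hVW.comp (hf i)).memLp_iff.mpr (hW.memLp i)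
  power i := by
    rw [← hW.power i]
    exact (hVW.comp (u := fun x => ‖f i x‖ ^ 2) (by fun_prop)).integral_eq
  uncorrelated i j hij := by
    rw [← hW.uncorrelated i j hij]
    exact (hVW.comp (u := fun x => f i x * star (f j x)) (by fun_prop)).integral_eq

variable [Fintype ι]

lemma hasMeanVariance_apply_stdComplexGaussianVec (i : ι) :
    HasMeanVariance (fun x => x i) 0 1 (stdComplexGaussianVec ι) :=
  .of_map (measurable_pi_apply i) <| by
    rw [(measurePreserving_eval (fun _ : ι => stdComplexGaussian) i).map_eq]
    exact hasMeanVariance_id_stdComplexGaussian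

lemma integral_star_smul_apply_stdComplexGaussianVec (σ : ℝ) (i : ι) :
    ∫ x : ι → ℂ, star ((σ • x) i) ∂(stdComplexGaussianVec ι) = 0 := by
  have h := (hasMeanVariance_apply_stdComplexGaussianVec i).mean
  simp_rw [Pi.smul_apply, Complex.star_def, integral_conj, integral_smul, h, smul_zero, map_zero]

lemma isWhite_star_smul_stdComplexGaussianVec (σ : ℝ) :
    IsWhite (fun i x => star ((σ • x) i)) (σ ^ 2) (stdComplexGaussianVec ι) := by
  have hmemLp (i : ι) : MemLp (fun x => star ((σ • x) i)) 2 (stdComplexGaussianVec ι) :=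
    ((hasMeanVariance_apply_stdComplexGaussianVec i).memLp.const_smul σ).star
  refine ⟨hmemLp, fun i => ?_, fun i j hij => ?_⟩
  · have h := (hasMeanVariance_apply_stdComplexGaussianVec i).variance
    simp only [sub_zero] at h
    simp [mul_pow, integral_const_mul, h]
  · have hindep : IndepFun (fun x : ι → ℂ => x i) (fun x => x j) (stdComplexGaussianVec ι) :=
      (iIndepFun_pi (μ := fun _ : ι => stdComplexGaussian) (X := fun _ => id)
        fun _ => aemeasurable_id).indepFun hij
    exact integral_mul_star_of_indepFun (hindep.comp (φ := fun z => star (σ • z))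
      (ψ := fun z => star (σ • z)) (by fun_prop) (by fun_prop)) (hmemLp i) (hmemLp j)
      (integral_star_smul_apply_stdComplexGaussianVec σ i)

lemma HasMeanVariance.star_dotProduct_add [IsProbabilityMeasure μ] {E W : Ω → ι → ℂ} {c : Ω → ℂ}
    {a : ℂ} {σ p v : ℝ} (hc : HasMeanVariance c a v μ) (hE : Measurable E)
    (hlaw : μ.map E = (stdComplexGaussianVec ι).map fun x => σ • x) (hW : Measurable W)
    (hp : HasMean (fun ω => sqNorm (W ω)) p μ) (hindep : IndepFun E (fun ω => (W ω, c ω)) μ) :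
    HasMeanVariance (fun ω => star (E ω) ⬝ᵥ W ω + c ω) a (σ ^ 2 * p + v) μ := by
  have hident : IdentDistrib E (fun x => σ • x) μ (stdComplexGaussianVec ι) :=
    ⟨hE.aemeasurable, by fun_prop, hlaw⟩
  have hmean (i) : ∫ ω, star (E ω i) ∂μ = 0 := by
    rw [← integral_star_smul_apply_stdComplexGaussianVec σ i]
    exact (hident.comp (u := fun x => star (x i)) (by fun_prop)).integral_eq
  have hWi (i) : Integrable (fun ω => ‖W ω i‖ ^ 2) μ :=
    hp.integrable.mono' (by fun_prop) (.of_forall fun ω => by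
      rw [norm_pow, norm_norm]
      exact Finset.single_le_sum (fun j _ => sq_nonneg ‖W ω j‖) (Finset.mem_univ i))
  have hwhite : IsWhite (fun i ω => star (E ω i)) (σ ^ 2) μ :=
    .of_identDistrib (f := fun i x => star (x i)) (by fun_prop) hident
      (isWhite_star_smul_stdComplexGaussianVec σ)
  rw [← hp.mean]
  unfold sqNorm
  rw [integral_finsetSum _ fun i _ => hWi i]
  exact hwhite.hasMeanVariance_sum_mul_add hmean
    (fun i => (memLp_two_iff_integrable_sq_norm (by fun_prop)).mpr (hWi i)) hc
    (hindep.comp (φ := fun (x : ι → ℂ) i => star (x i)) (ψ := id) (by fun_prop) measurable_id)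

end SecondMoments

section EstimatedGain

variable {Ω m κ : Type*} [MeasurableSpace Ω] {μ : Measure Ω} [Fintype m]
  {H : κ → Ω → m → ℂ} {σ : κ → ℝ}

lemma HasMean.of_identDistrib {Ω' : Type*} [MeasurableSpace Ω'] {ν : Measure Ω'} {f : Ω → ℝ}
    {g : Ω' → ℝ} {c : ℝ} (hfg : IdentDistrib f g μ ν) (hg : HasMean g c ν) : HasMean f c μ :=
  ⟨hfg.integrable_iff.mpr hg.integrable, by rw [hfg.integral_eq, hg.mean]⟩

lemma HasMean.congr {f g : Ω → ℝ} {c : ℝ} (hf : HasMean f c μ) (hfg : f =ᵐ[μ] g) : HasMean g c μ :=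
  ⟨hf.integrable.congr hfg, by rw [← integral_congr_ae hfg, hf.mean]⟩

lemma measurable_star_dotProduct {α : Type*} [MeasurableSpace α] {f g : α → m → ℂ}
    (hf : Measurable f) (hg : Measurable g) : Measurable fun x => star (f x) ⬝ᵥ g x :=
  Finset.measurable_fun_sum _ fun a _ =>
    (continuous_star.measurable.comp ((measurable_pi_apply a).comp hf)).mul
      ((measurable_pi_apply a).comp hg)

namespace IsIndepGaussian

variable {S T : Finset κ} {k : κ}

lemma indepFun_finset (hH : IsIndepGaussian H σ μ) (hk : k ∉ T) :
    IndepFun (fun ω (i : T) => H i ω) (H k) μ :=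
  (hH.indep.indepFun_finset T {k} (Finset.disjoint_singleton_right.mpr hk) hH.measurable).comp
    (φ := id) (ψ := fun x : ({k} : Finset κ) → m → ℂ => x ⟨k, Finset.mem_singleton_self k⟩)
    measurable_id (by fun_prop)

variable [DecidableEq κ] [DecidableEq m]

lemma measurable_sqNorm_orthProj_mulVec (hH : IsIndepGaussian H σ μ) (T : Finset κ) (k : κ) :
    Measurable fun ω => sqNorm (orthProj (fun i : T => H i ω) *ᵥ H k ω) := by
  have hcomp : (fun ω => sqNorm (orthProj (fun i : T => H i ω) *ᵥ H k ω))
      = (fun p : (T → m → ℂ) × (m → ℂ) => sqNorm (orthProj p.1 *ᵥ p.2)) ∘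
        fun ω => (fun i : T => H i ω, H k ω) := rfl
  rw [hcomp]
  exact (measurable_sqNorm.comp measurable_orthProj_mulVec).comp
    ((measurable_pi_lambda _ fun i : T => hH.measurable i).prodMk (hH.measurable k))

lemma measurable_precoder (hH : IsIndepGaussian H σ μ) (S : Finset κ) (k : κ) :
    Measurable fun ω => precoder S (fun j => H j ω) k := by
  have hcomp : (fun ω => precoder S (fun j => H j ω) k)
      = (fun G : κ → m → ℂ => precoder S G k) ∘ fun ω j => H j ω := rfl
  rw [hcomp]
  exact (CellFree.measurable_precoder S k).comp (measurable_pi_lambda _ hH.measurable)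

lemma indepFun_precoder (hH : IsIndepGaussian H σ μ) {t : κ} (hk : k ∉ S) (htk : t ≠ k) :
    IndepFun (H k) (fun ω => precoder S (fun j => H j ω) t) μ := by
  let extend (x : ↥(insert t S) → m → ℂ) (j : κ) : m → ℂ :=
    if hj : j ∈ insert t S then x ⟨j, hj⟩ else 0
  have hextend : Measurable extend := measurable_pi_lambda _ fun j => by
    by_cases hj : j ∈ insert t S <;> simp only [extend, hj, dite_true, dite_false] <;> fun_prop
  have hprecoder : (fun ω => precoder S (fun j => H j ω) t)
      = (fun x => precoder S (extend x) t) ∘ fun ω (i : ↥(insert t S)) => H i ω := by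
    funext ω
    exact precoder_congr (fun i hi => by simp [extend, hi]) (by simp [extend])
  rw [hprecoder]
  exact ((hH.indepFun_finset (T := insert t S) (by simp [hk, htk.symm])).comp
    ((CellFree.measurable_precoder S t).comp hextend) measurable_id).symm

variable [IsProbabilityMeasure μ] {d : ℕ}

lemma identDistrib_sqNorm_orthProj_mulVec {n : ℕ} (hH : IsIndepGaussian H σ μ)
    (hlin : ∀ᵐ ω ∂μ, LinearIndepOn ℂ (fun i => H i ω) (T : Set κ))
    (hT : T.card + n = Fintype.card m) (hk : k ∉ T) :
    IdentDistrib (fun ω => sqNorm (orthProj (fun i : T => H i ω) *ᵥ H k ω))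
      (fun y => σ k ^ 2 * sqNorm y) μ (stdComplexGaussianVec (Fin n)) where
  aemeasurable_fst := (hH.measurable_sqNorm_orthProj_mulVec T k).aemeasurable
  aemeasurable_snd := by fun_prop
  map_eq := by
    refine map_eq_of_indepFun_of_forall_map_eq
      (f := fun p : (T → m → ℂ) × (m → ℂ) => sqNorm (orthProj p.1 *ᵥ p.2))
      (measurable_pi_lambda _ fun i : T => hH.measurable i) (hH.measurable k)
      (hH.indepFun_finset hk) (measurable_sqNorm.comp measurable_orthProj_mulVec) ?_
    filter_upwards [hlin] with ω hω
    set B := orthProj fun i : T => H i ω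
    have hscale : (fun y => sqNorm (B *ᵥ y)) ∘ (fun x => σ k • x)
        = (fun r => σ k ^ 2 * r) ∘ fun x => sqNorm (B *ᵥ x) := by
      funext x
      simp [mulVec_smul, sqNorm_smul]
    have htrace : B.trace = n := trace_orthProj hω (by simpa using hT)
    rw [hH.law k, Measure.map_map (by fun_prop) (by fun_prop), hscale,
      ← Measure.map_map (by fun_prop) (by fun_prop),
      map_sqNorm_mulVec_of_isStarProjection (isStarProjection_orthProj _) htrace,
      Measure.map_map (by fun_prop) (by fun_prop)]
    rfl

omit [DecidableEq κ] [DecidableEq m] in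
lemma ae_linearIndepOn (hH : IsIndepGaussian H σ μ) (hσ : ∀ i, 0 < σ i)
    (hT : T.card ≤ Fintype.card m) :
    ∀ᵐ ω ∂μ, LinearIndepOn ℂ (fun i => H i ω) (T : Set κ) := by
  classical
  induction T using Finset.induction_on with
  | empty => simp
  | insert k T hk ih =>
    rw [Finset.card_insert_of_notMem hk] at hT
    obtain ⟨n, hn⟩ := Nat.exists_eq_add_of_le hT
    have hlin := ih (by omega)
    have hpos : ∀ᵐ ω ∂μ, 0 < sqNorm (orthProj (fun i : T => H i ω) *ᵥ H k ω) :=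
      (hH.identDistrib_sqNorm_orthProj_mulVec hlin (n := n + 1) (by omega) hk).symm.ae_snd
        measurableSet_Ioi <| ae_sqNorm_pos_stdComplexGaussianVec.mono fun y hy => by
          have := hσ k
          positivity
    filter_upwards [hlin, hpos] with ω hω hωk
    rw [Finset.coe_insert, linearIndepOn_insert (by exact_mod_cast hk)]
    refine ⟨hω, fun hspan => hωk.ne' ?_⟩
    have hker : Submodule.span ℂ ((fun i => H i ω) '' (T : Set κ))
        ≤ LinearMap.ker (toLin' (orthProj fun i : T => H i ω)) := by
      rw [Submodule.span_le, Set.image_subset_iff]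
      exact fun i hi => orthProj_mulVec_self (H := fun i : T => H i ω) hω ⟨i, hi⟩
    have hzero : orthProj (fun i : T => H i ω) *ᵥ H k ω = 0 := hker hspan
    simp [hzero, sqNorm]

lemma hasMean_sqNorm_precoder (hH : IsIndepGaussian H σ μ) (hσ : ∀ i, 0 < σ i)
    (hS : S.card + (d + 1) = Fintype.card m) (k : κ) :
    HasMean (fun ω => sqNorm (precoder S (fun j => H j ω) k))
      (if k ∈ S then (σ k ^ 2 * (d + 1))⁻¹ else σ k ^ 2 * (d + 1)) μ := by
  have hlin := hH.ae_linearIndepOn hσ (T := S) (by omega)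
  by_cases hk : k ∈ S
  · have hcard : (S.erase k).card + (d + 2) = Fintype.card m := by
      rw [← hS, ← Finset.card_erase_add_one hk]
      ring
    have hresidual := hH.identDistrib_sqNorm_orthProj_mulVec
      (hH.ae_linearIndepOn hσ (by omega)) hcard (Finset.notMem_erase k S)
    have hinv : HasMean (fun y => (σ k ^ 2 * sqNorm y)⁻¹) (σ k ^ 2 * (d + 1))⁻¹
        (stdComplexGaussianVec (Fin (d + 2))) := by
      simp_rw [mul_inv]
      simpa using (hasMean_inv_sqNorm_stdComplexGaussianVec (m := d) (by simp)).const_mul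
        (σ k ^ 2)⁻¹
    rw [if_pos hk]
    refine (HasMean.of_identDistrib (hresidual.comp measurable_inv) hinv).congr ?_
    filter_upwards [hlin] with ω hω
    rw [precoder, dif_pos hk, sqNorm_dualVector hω hk]
    rfl
  · rw [if_neg hk]
    simp_rw [precoder, dif_neg hk]
    refine .of_identDistrib (hH.identDistrib_sqNorm_orthProj_mulVec hlin hS hk) ?_
    simpa using (hasMean_sqNorm_stdComplexGaussianVec (ι := Fin (d + 1))).const_mul (σ k ^ 2)

end IsIndepGaussian

variable [DecidableEq κ] [DecidableEq m]

/-- The partial zero-forcing precoder for the random estimates `H`, scaled to unit mean power. -/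
def normalizedPrecoder (S : Finset κ) (H : κ → Ω → m → ℂ) (μ : Measure Ω) (k : κ) (ω : Ω) : m → ℂ :=
  ((1 / √(∫ ω', ∑ a, ‖precoder S (fun j => H j ω') k a‖ ^ 2 ∂μ) : ℝ) : ℂ) •
    precoder S (fun j => H j ω) k

lemma indepFun_normalizedPrecoder_gain {α : Type*} [MeasurableSpace α] {E : Ω → α}
    (hE : IndepFun E (fun ω j => H j ω) μ) (S : Finset κ) (k t : κ) :
    IndepFun E (fun ω => (normalizedPrecoder S H μ t ω,
      star (H k ω) ⬝ᵥ normalizedPrecoder S H μ t ω)) μ := by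
  let c : ℂ := ((1 / √(∫ ω', ∑ a, ‖precoder S (fun j => H j ω') t a‖ ^ 2 ∂μ) : ℝ) : ℂ)
  have hweight : Measurable fun G : κ → m → ℂ => c • precoder S G t :=
    (measurable_precoder S t).fun_const_smul c
  exact hE.comp measurable_id
    (hweight.prodMk (measurable_star_dotProduct (measurable_pi_apply k) hweight))

namespace IsIndepGaussian

lemma measurable_normalizedPrecoder (hH : IsIndepGaussian H σ μ) (S : Finset κ) (k : κ) :
    Measurable (normalizedPrecoder S H μ k) :=
  (hH.measurable_precoder S k).fun_const_smul _

variable [IsProbabilityMeasure μ] {S : Finset κ} {k t : κ} {d : ℕ}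

lemma normalizedPrecoder_eq (hH : IsIndepGaussian H σ μ) (hσ : ∀ i, 0 < σ i)
    (hS : S.card + (d + 1) = Fintype.card m) (k : κ) (ω : Ω) :
    normalizedPrecoder S H μ k ω = (if k ∈ S then √(d + 1) * σ k else (√(d + 1) * σ k)⁻¹ : ℝ) •
      precoder S (fun j => H j ω) k := by
  rw [normalizedPrecoder, show ∫ ω', ∑ a, ‖precoder S (fun j => H j ω') k a‖ ^ 2 ∂μ = _ from
    (hH.hasMean_sqNorm_precoder hσ hS k).mean, Complex.coe_smul]
  congr 1
  have h : √(σ k ^ 2 * (d + 1)) = √(d + 1) * σ k := by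
    rw [mul_comm, Real.sqrt_mul (by positivity), Real.sqrt_sq (hσ k).le]
  split_ifs
  · rw [Real.sqrt_inv, h, one_div, inv_inv]
  · rw [h, one_div]

lemma hasMean_sqNorm_normalizedPrecoder (hH : IsIndepGaussian H σ μ) (hσ : ∀ i, 0 < σ i)
    (hS : S.card + (d + 1) = Fintype.card m) (k : κ) :
    HasMean (fun ω => sqNorm (normalizedPrecoder S H μ k ω)) 1 μ := by
  have hroot : √(d + 1 : ℝ) ^ 2 = d + 1 := Real.sq_sqrt (by positivity)
  have hσk := (hσ k).ne'
  simp_rw [hH.normalizedPrecoder_eq hσ hS, sqNorm_smul]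
  convert (hH.hasMean_sqNorm_precoder hσ hS k).const_mul _ using 1
  split_ifs <;> field_simp <;> rw [hroot]

lemma hasMeanVariance_gain_of_mem (hH : IsIndepGaussian H σ μ) (hσ : ∀ i, 0 < σ i)
    (hS : S.card + (d + 1) = Fintype.card m) (hk : k ∈ S) :
    HasMeanVariance (fun ω => star (H k ω) ⬝ᵥ normalizedPrecoder S H μ t ω)
      ((if t = k then √(d + 1) * σ k else 0 : ℝ) : ℂ) 0 μ := by
  refine (hasMeanVariance_const _).congr ?_
  filter_upwards [hH.ae_linearIndepOn hσ (T := S) (by omega)] with ω hω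
  rw [hH.normalizedPrecoder_eq hσ hS, dotProduct_smul, star_dotProduct_precoder_of_mem hω hk]
  split_ifs with htk htS <;> simp_all

lemma hasMeanVariance_gain_self_of_notMem (hH : IsIndepGaussian H σ μ) (hσ : ∀ i, 0 < σ i)
    (hS : S.card + (d + 1) = Fintype.card m) (hk : k ∉ S) :
    HasMeanVariance (fun ω => star (H k ω) ⬝ᵥ normalizedPrecoder S H μ k ω)
      ((√(d + 1) * σ k : ℝ) : ℂ) (σ k ^ 2) μ := by
  have hresidual := hH.identDistrib_sqNorm_orthProj_mulVec
    (hH.ae_linearIndepOn hσ (T := S) (by omega)) hS hk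
  have hmean : HasMean (fun y : Fin (d + 1) → ℂ => σ k ^ 2 * sqNorm y) (σ k ^ 2 * (d + 1))
      (stdComplexGaussianVec (Fin (d + 1))) := by
    simpa using (hasMean_sqNorm_stdComplexGaussianVec (ι := Fin (d + 1))).const_mul (σ k ^ 2)
  have hmean_sq : HasMean (fun y : Fin (d + 1) → ℂ => (σ k ^ 2 * sqNorm y) ^ 2)
      (σ k ^ 4 * (d + 1) + (σ k ^ 2 * (d + 1)) ^ 2) (stdComplexGaussianVec (Fin (d + 1))) := by
    simp_rw [mul_pow]
    convert (hasMean_sqNorm_sq_stdComplexGaussianVec (ι := Fin (d + 1))).const_mul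
      ((σ k ^ 2) ^ 2) using 1
    simp only [Fintype.card_fin]
    push_cast
    ring
  have hgain := (hasMeanVariance_ofReal (.of_identDistrib hresidual hmean)
    (.of_identDistrib (hresidual.comp (u := (· ^ 2)) (by fun_prop)) hmean_sq)).const_mul
    ((√(d + 1) * σ k)⁻¹ : ℝ)
  have hroot : √(d + 1 : ℝ) ^ 2 = d + 1 := Real.sq_sqrt (by positivity)
  have hσk := (hσ k).ne'
  convert hgain using 1
  · funext ω
    rw [hH.normalizedPrecoder_eq hσ hS, if_neg hk, dotProduct_smul,
      star_dotProduct_precoder_of_notMem (H := fun j => H j ω) hk, Complex.real_smul]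
  · rw [← Complex.ofReal_mul]
    congr 1
    field_simp
    exact hroot
  · rw [Complex.norm_real, Real.norm_eq_abs, sq_abs]
    field_simp
    exact hroot

lemma hasMeanVariance_gain_of_ne_of_notMem (hH : IsIndepGaussian H σ μ) (hσ : ∀ i, 0 < σ i)
    (hS : S.card + (d + 1) = Fintype.card m) (hk : k ∉ S) (htk : t ≠ k) :
    HasMeanVariance (fun ω => star (H k ω) ⬝ᵥ normalizedPrecoder S H μ t ω) 0 (σ k ^ 2) μ := by
  have h := (hasMeanVariance_const (μ := μ) 0).star_dotProduct_add (hH.measurable k) (hH.law k)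
    (hH.measurable_normalizedPrecoder S t) (hH.hasMean_sqNorm_normalizedPrecoder hσ hS t)
    ((hH.indepFun_precoder hk htk).comp (φ := id) (ψ := fun x => (_ • x, 0)) measurable_id
      (by fun_prop))
  simpa using h

lemma hasMeanVariance_gain (hH : IsIndepGaussian H σ μ) (hσ : ∀ i, 0 < σ i)
    (hS : S.card + (d + 1) = Fintype.card m) (k t : κ) :
    HasMeanVariance (fun ω => star (H k ω) ⬝ᵥ normalizedPrecoder S H μ t ω)
      ((if t = k then √(d + 1) * σ k else 0 : ℝ) : ℂ) (if k ∈ S then 0 else σ k ^ 2) μ := by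
  by_cases hk : k ∈ S
  · rw [if_pos hk]
    exact hH.hasMeanVariance_gain_of_mem hσ hS hk
  rw [if_neg hk]
  split_ifs with htk
  · subst htk
    exact hH.hasMeanVariance_gain_self_of_notMem hσ hS hk
  · exact hH.hasMeanVariance_gain_of_ne_of_notMem hσ hS hk htk

end IsIndepGaussian

end EstimatedGain

section Training

variable {L K M τ : ℕ} {Ω : Type*}

/-- The standing assumptions on the parameters. -/
structure Params.IsValid (P : Params L K M τ) : Prop where
  β_pos : ∀ l k, 0 < P.β l k
  βE_nonneg : ∀ l, 0 ≤ P.βE l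
  ρu_pos : 0 < P.ρu
  ρE_nonneg : 0 ≤ P.ρE
  ρ_nonneg : ∀ l k, 0 ≤ P.ρ l k
  orthonormal : Orthonormal ℂ P.φ
  card_lt : ∀ l, (P.S l).card < M

lemma Params.IsValid.exists_card_add_eq {P : Params L K M τ} (hP : P.IsValid) (l : Fin L) :
    ∃ d : ℕ, (P.S l).card + (d + 1) = Fintype.card (Fin M) := by
  obtain ⟨d, hd⟩ := Nat.exists_eq_add_of_lt (hP.card_lt l)
  exact ⟨d, by rw [Fintype.card_fin, ← add_assoc, ← hd]⟩

/-- The sources of randomness at AP `l` as a family of vectors in `ℂ^M`, one for each user, one for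
the eavesdropper and one for each time slot of the training phase. -/
def sourceIndex (l : Fin L) : (Fin K ⊕ Unit ⊕ Fin τ) × Fin M →
    (Fin L × Fin K × Fin M) ⊕ (Fin L × Fin M) ⊕ (Fin L × Fin M × Fin τ)
  | (.inl k, a) => .inl (l, k, a)
  | (.inr (.inl _), a) => .inr (.inl (l, a))
  | (.inr (.inr i), a) => .inr (.inr (l, a, i))

lemma eq_of_sourceIndex_eq {l l' : Fin L} {p p' : (Fin K ⊕ Unit ⊕ Fin τ) × Fin M}
    (h : sourceIndex l p = sourceIndex l' p') : l = l' ∧ p = p' := by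
  obtain ⟨_ | _ | _, a⟩ := p <;> obtain ⟨_ | _ | _, a'⟩ := p' <;> simp_all [sourceIndex]

/-- The random variables of a block that belong to AP `l`. -/
def Block.source (X : Block L K M τ Ω) (l : Fin L) (ω : Ω) :
    (Fin K ⊕ Unit ⊕ Fin τ) × Fin M → ℂ :=
  fun p => X.family (sourceIndex l p) ω

namespace Block.IsRayleigh

variable [MeasurableSpace Ω] {μ : Measure Ω} {X : Block L K M τ Ω}

lemma measurable_source (hX : X.IsRayleigh μ) (l : Fin L) : Measurable (X.source l) :=
  measurable_pi_lambda _ fun _ => hX.measurable _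

lemma map_source [IsProbabilityMeasure μ] (hX : X.IsRayleigh μ) (l : Fin L) :
    μ.map (X.source l) = stdComplexGaussianVec _ := by
  have hindep := hX.indep.precomp fun _ _ h => (eq_of_sourceIndex_eq (l := l) (l' := l) h).2
  rw [iIndepFun_iff_map_fun_eq_pi_map fun _ => (hX.measurable _).aemeasurable] at hindep
  simp_rw [hX.law] at hindep
  exact hindep

lemma indepFun_source (hX : X.IsRayleigh μ) {l l' : Fin L} (hl : l ≠ l') :
    IndepFun (X.source l) (X.source l') μ := by
  have hdisj : Disjoint (Finset.univ.image (sourceIndex (K := K) (M := M) (τ := τ) l))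
      (Finset.univ.image (sourceIndex l')) := by
    simp only [Finset.disjoint_left, Finset.mem_image, Finset.mem_univ, true_and]
    rintro _ ⟨p, rfl⟩ ⟨p', hp⟩
    exact hl (eq_of_sourceIndex_eq hp).1.symm
  exact (hX.indep.indepFun_finset _ _ hdisj hX.measurable).comp
    (φ := fun x p => x ⟨sourceIndex l p, Finset.mem_image_of_mem _ (Finset.mem_univ p)⟩)
    (ψ := fun x p => x ⟨sourceIndex l' p, Finset.mem_image_of_mem _ (Finset.mem_univ p)⟩)
    (by fun_prop) (by fun_prop)

end Block.IsRayleigh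

namespace Params

lemma star_pilot_dotProduct_pilot {P : Params L K M τ} (hφ : Orthonormal ℂ P.φ) (i j : Fin K) :
    star (P.φ i).ofLp ⬝ᵥ (P.φ j).ofLp = if i = j then 1 else 0 := by
  rw [← orthonormal_iff_ite.mp hφ i j, EuclideanSpace.inner_eq_star_dotProduct, dotProduct_comm]

variable (P : Params L K M τ) (X : Block L K M τ Ω)

/-- The coefficients of the channel of user `k` in the sources at AP `l`. -/
def channelRow (l : Fin L) (k : Fin K) : Fin K ⊕ Unit ⊕ Fin τ → ℂ :=
  Pi.single (.inl k) (√(P.β l k) : ℂ)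

lemma h_eq_sum (l : Fin L) (k : Fin K) (ω : Ω) :
    P.h X l k ω = fun a => ∑ s, P.channelRow l k s * X.source l ω (s, a) := by
  funext a
  rw [← dotProduct, channelRow, single_dotProduct]
  rfl

lemma channelRow_dotProduct_star_self {l : Fin L} {k : Fin K} (hβ : 0 ≤ P.β l k) :
    P.channelRow l k ⬝ᵥ star (P.channelRow l k) = P.β l k := by
  rw [channelRow, single_dotProduct, Pi.star_apply, Pi.single_eq_same, Complex.star_def,
    Complex.conj_ofReal, ← Complex.ofReal_mul, Real.mul_self_sqrt hβ]

variable [NeZero K]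

/-- The coefficients, in the sources at AP `l`, of the received pilot matrix applied to the pilot of
user `j`. -/
def pilotRow (l : Fin L) (j : Fin K) : Fin K ⊕ Unit ⊕ Fin τ → ℂ :=
  Sum.elim (Pi.single j (√(τ * P.ρu) * √(P.β l j) : ℂ))
    (Sum.elim (fun _ => if j = 0 then (√(τ * P.ρE) * √(P.βE l) : ℂ) else 0) (P.φ j).ofLp)

/-- The coefficients of the channel estimate of user `j` in the sources at AP `l`. -/
def estimateRow (l : Fin L) (j : Fin K) : Fin K ⊕ Unit ⊕ Fin τ → ℂ :=
  ((√(τ * P.ρu) * P.β l j / P.pilotVar l j : ℝ) : ℂ) • P.pilotRow l j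

/-- The matrix whose rows are the coefficients, in the sources at AP `l`, of the estimation error of
user `k` (row `none`) and of the channel estimates (row `some j`). -/
def estimationMatrix (l : Fin L) (k : Fin K) : Matrix (Option (Fin K)) (Fin K ⊕ Unit ⊕ Fin τ) ℂ :=
  Matrix.of fun o => o.elim (P.channelRow l k - P.estimateRow l k) (P.estimateRow l)

lemma pilotVar_eq (l : Fin L) (j : Fin K) :
    P.pilotVar l j = τ * P.ρu * P.β l j + (if j = 0 then τ * P.ρE * P.βE l else 0) + 1 := by
  unfold pilotVar
  split_ifs <;> simp

variable {P}

lemma Y_mulVec_pilot (hφ : Orthonormal ℂ P.φ) (l : Fin L) (j : Fin K) (ω : Ω) :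
    P.Y X l ω *ᵥ (P.φ j).ofLp = (√(τ * P.ρu) : ℂ) • P.h X l j ω
      + (if j = 0 then (√(τ * P.ρE) : ℂ) • P.hE X l ω else 0)
      + (Matrix.of fun m i => X.N l m i ω) *ᵥ (P.φ j).ofLp := by
  simp [Y, add_mulVec, smul_mulVec, sum_mulVec, vecMulVec_mulVec,
    star_pilot_dotProduct_pilot hφ, ite_smul, eq_comm]

lemma hhat_eq_sum (hφ : Orthonormal ℂ P.φ) (l : Fin L) (j : Fin K) (ω : Ω) :
    P.hhat X l j ω = fun a => ∑ s, P.estimateRow l j s * X.source l ω (s, a) := by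
  funext a
  simp only [hhat, Y_mulVec_pilot X hφ, estimateRow, pilotRow, Pi.smul_apply, Pi.add_apply,
    smul_eq_mul, mul_assoc, ← Finset.mul_sum, Fintype.sum_sum_type, Sum.elim_inl, Sum.elim_inr,
    Pi.single_apply, ite_mul, zero_mul, Finset.sum_ite_eq', Finset.mem_univ, if_true,
    Finset.univ_unique, Finset.sum_singleton, mulVec, dotProduct, add_assoc]
  congr 2
  congr 1
  · split_ifs <;> rfl
  · exact Finset.sum_congr rfl fun _ _ => mul_comm _ _

namespace IsValid

variable (hP : P.IsValid)
include hP

lemma τ_pos : (0 : ℝ) < τ := by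
  rcases Nat.eq_zero_or_pos τ with rfl | h
  · exact absurd (Subsingleton.elim _ _) (hP.orthonormal.ne_zero 0)
  · exact_mod_cast h

variable (l : Fin L) (i j k : Fin K)

lemma mul_β_lt_pilotVar : τ * P.ρu * P.β l j < P.pilotVar l j := by
  have := mul_nonneg (mul_nonneg hP.τ_pos.le hP.ρE_nonneg) (hP.βE_nonneg l)
  rw [pilotVar_eq]
  split_ifs <;> linarith

lemma pilotVar_pos : 0 < P.pilotVar l j :=
  (mul_pos (mul_pos hP.τ_pos hP.ρu_pos) (hP.β_pos l j)).trans (hP.mul_β_lt_pilotVar l j)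

lemma γ_pos : 0 < P.γ l j :=
  div_pos (mul_pos (mul_pos hP.τ_pos hP.ρu_pos) (pow_pos (hP.β_pos l j) 2)) (hP.pilotVar_pos l j)

lemma γ_lt_β : P.γ l j < P.β l j := by
  rw [γ, div_lt_iff₀ (hP.pilotVar_pos l j), sq, ← mul_assoc, mul_comm (P.β l j)]
  exact mul_lt_mul_of_pos_right (hP.mul_β_lt_pilotVar l j) (hP.β_pos l j)

lemma pilotRow_dotProduct_star :
    P.pilotRow l i ⬝ᵥ star (P.pilotRow l j) = if i = j then (P.pilotVar l i : ℂ) else 0 := by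
  have hpilot := star_pilot_dotProduct_pilot hP.orthonormal j i
  rw [dotProduct_comm] at hpilot
  simp only [pilotRow, Function.star_sumElim, sumElim_dotProduct_sumElim, hpilot,
    single_dotProduct]
  by_cases hij : i = j
  · subst hij
    have hu : (√(τ * P.ρu) : ℂ) ^ 2 = τ * P.ρu := by
      exact_mod_cast Real.sq_sqrt (mul_pos hP.τ_pos hP.ρu_pos).le
    have hβ : (√(P.β l i) : ℂ) ^ 2 = P.β l i := by exact_mod_cast Real.sq_sqrt (hP.β_pos l i).le
    have hE : (√(τ * P.ρE) : ℂ) ^ 2 = τ * P.ρE := by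
      exact_mod_cast Real.sq_sqrt (mul_nonneg hP.τ_pos.le hP.ρE_nonneg)
    have hβE : (√(P.βE l) : ℂ) ^ 2 = P.βE l := by exact_mod_cast Real.sq_sqrt (hP.βE_nonneg l)
    rw [pilotVar_eq]
    by_cases h0 : i = 0
    · simp only [h0, dotProduct, Pi.star_apply, Pi.single_eq_same, star_mul', Complex.star_def,
        Complex.conj_ofReal, if_true, Finset.univ_unique, Finset.sum_singleton] at hu hβ hE hβE ⊢
      push_cast
      linear_combination (√(P.β l 0) : ℂ) ^ 2 * hu + τ * P.ρu * hβ
        + (√(P.βE l) : ℂ) ^ 2 * hE + τ * P.ρE * hβE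
    · simp only [h0, dotProduct, Pi.star_apply, Pi.single_eq_same, star_mul', Complex.star_def,
        Complex.conj_ofReal, if_true, if_false, Finset.univ_unique, Finset.sum_singleton, zero_mul]
      push_cast
      linear_combination (√(P.β l i) : ℂ) ^ 2 * hu + τ * P.ρu * hβ
  · have hij' : ¬ (i = 0 ∧ j = 0) := fun h => hij (h.1.trans h.2.symm)
    have hsingle : star (Pi.single j (√(τ * P.ρu) * √(P.β l j) : ℂ) : Fin K → ℂ) i = 0 := by
      rw [Pi.star_apply, Pi.single_eq_of_ne hij, star_zero]
    rw [hsingle, if_neg hij, if_neg (Ne.symm hij)]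
    by_cases h0 : i = 0 <;> simp_all [dotProduct]

lemma estimateRow_dotProduct_star :
    P.estimateRow l i ⬝ᵥ star (P.estimateRow l j) = if i = j then (P.γ l i : ℂ) else 0 := by
  rw [estimateRow, estimateRow, star_smul, smul_dotProduct, dotProduct_smul,
    hP.pilotRow_dotProduct_star, Complex.star_def, Complex.conj_ofReal]
  split_ifs with hij
  · subst hij
    have hsq : √(τ * P.ρu) ^ 2 = τ * P.ρu := Real.sq_sqrt (mul_pos hP.τ_pos hP.ρu_pos).le
    have hv := (hP.pilotVar_pos l i).ne'
    simp only [smul_eq_mul]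
    norm_cast
    rw [γ]
    field_simp
    rw [hsq]
  · simp

lemma channelRow_dotProduct_star_estimateRow :
    P.channelRow l k ⬝ᵥ star (P.estimateRow l j) = if k = j then (P.γ l k : ℂ) else 0 := by
  rw [channelRow, single_dotProduct, estimateRow, pilotRow, Pi.star_apply, Pi.smul_apply,
    Sum.elim_inl, Pi.single_apply]
  split_ifs with hkj
  · subst hkj
    have hsq : √(τ * P.ρu) ^ 2 = τ * P.ρu := Real.sq_sqrt (mul_pos hP.τ_pos hP.ρu_pos).le
    have hsqβ : √(P.β l k) ^ 2 = P.β l k := Real.sq_sqrt (hP.β_pos l k).le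
    simp only [smul_eq_mul, star_mul', Complex.star_def, Complex.conj_ofReal]
    norm_cast
    rw [γ]
    linear_combination (√(τ * P.ρu) ^ 2 * P.β l k / P.pilotVar l k) * hsqβ
      + (P.β l k ^ 2 / P.pilotVar l k) * hsq
  · simp

lemma estimationMatrix_mul_conjTranspose :
    P.estimationMatrix l k * (P.estimationMatrix l k)ᴴ = diagonal fun o : Option (Fin K) =>
      ((o.elim √(P.β l k - P.γ l k) fun j => √(P.γ l j) : ℝ) : ℂ) ^ 2 := by
  have herror : (√(P.β l k - P.γ l k) : ℂ) ^ 2 = P.β l k - P.γ l k := by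
    exact_mod_cast Real.sq_sqrt (sub_pos.mpr (hP.γ_lt_β l k)).le
  have hestimate (j) : (√(P.γ l j) : ℂ) ^ 2 = P.γ l j := by
    exact_mod_cast Real.sq_sqrt (hP.γ_pos l j).le
  have hcross (j) : P.estimateRow l j ⬝ᵥ star (P.channelRow l k)
      = if k = j then (P.γ l k : ℂ) else 0 := by
    rw [dotProduct_star, hP.channelRow_dotProduct_star_estimateRow]
    split_ifs <;> simp
  have hentry (o o') : (P.estimationMatrix l k * (P.estimationMatrix l k)ᴴ) o o'
      = (P.estimationMatrix l k).row o ⬝ᵥ star ((P.estimationMatrix l k).row o') := rfl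
  have hnone : (P.estimationMatrix l k).row none = P.channelRow l k - P.estimateRow l k := rfl
  have hsome (j) : (P.estimationMatrix l k).row (some j) = P.estimateRow l j := rfl
  ext (_ | i) (_ | j) <;>
    simp +contextual [hentry, hnone, hsome, diagonal_apply, sub_dotProduct, dotProduct_sub, hcross,
      channelRow_dotProduct_star_self P (hP.β_pos l k).le, herror, hestimate,
      hP.channelRow_dotProduct_star_estimateRow, hP.estimateRow_dotProduct_star, eq_comm]

variable [MeasurableSpace Ω] {μ : Measure Ω} [IsProbabilityMeasure μ] {X} (hX : X.IsRayleigh μ)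
include hX

lemma isIndepGaussian_error_and_estimates :
    IsIndepGaussian (fun (o : Option (Fin K)) ω =>
        o.elim (P.h X l k ω - P.hhat X l k ω) fun j => P.hhat X l j ω)
      (fun o => o.elim √(P.β l k - P.γ l k) fun j => √(P.γ l j)) μ := by
  convert isIndepGaussian_of_mul_conjTranspose_eq (hX.measurable_source l) (hX.map_source l)
    (hP.estimationMatrix_mul_conjTranspose l k) using 1
  funext o ω
  rcases o with _ | j
  · simp only [Option.elim_none, h_eq_sum, hhat_eq_sum X hP.orthonormal]
    funext a
    simp [estimationMatrix, sub_mul]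
  · exact hhat_eq_sum X hP.orthonormal l j ω

lemma isIndepGaussian_hhat :
    IsIndepGaussian (P.hhat X l) (fun j => √(P.γ l j)) μ := by
  have h := hP.isIndepGaussian_error_and_estimates l 0 hX
  have hindep := h.indep.precomp (g := (some : Fin K → Option (Fin K))) (Option.some_injective _)
  exact ⟨fun j => h.measurable (some j), hindep, fun j => h.law (some j)⟩

lemma indepFun_error_hhat :
    IndepFun (fun ω => P.h X l k ω - P.hhat X l k ω) (fun ω j => P.hhat X l j ω) μ := by
  have h := hP.isIndepGaussian_error_and_estimates l k hX
  have hindep := h.indepFun_finset (T := Finset.univ.erase none) (k := none) (by simp)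
  exact hindep.symm.comp (φ := id)
    (ψ := fun (x : ↥(Finset.univ.erase (none : Option (Fin K))) → Fin M → ℂ) (j : Fin K) =>
      x ⟨some j, by simp⟩)
    measurable_id (by fun_prop)

end IsValid

end Params

end Training

section Gain

variable {L K M τ : ℕ} {Ω : Type*} [NeZero K] [MeasurableSpace Ω] {μ : Measure Ω}
  {P : Params L K M τ} {X : Block L K M τ Ω}

namespace Params

/-- The effective scalar channel from the signal that AP `l` intends for user `t` to user `k`. -/
def gain (P : Params L K M τ) (X : Block L K M τ Ω) (μ : Measure Ω) (l : Fin L) (k t : Fin K)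
    (ω : Ω) : ℂ :=
  star (P.h X l k ω) ⬝ᵥ P.w X μ l t ω

lemma exists_measurable_gain_eq (hφ : Orthonormal ℂ P.φ) (l : Fin L) (k t : Fin K) :
    ∃ f : ((Fin K ⊕ Unit ⊕ Fin τ) × Fin M → ℂ) → ℂ,
      Measurable f ∧ P.gain X μ l k t = f ∘ X.source l := by
  have hmix (r : Fin K ⊕ Unit ⊕ Fin τ → ℂ) : Measurable
      fun (x : (Fin K ⊕ Unit ⊕ Fin τ) × Fin M → ℂ) (a : Fin M) => ∑ s, r s * x (s, a) := by
    fun_prop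
  have hhat : Measurable fun (x : (Fin K ⊕ Unit ⊕ Fin τ) × Fin M → ℂ) j (a : Fin M) =>
      ∑ s, P.estimateRow l j s * x (s, a) := measurable_pi_lambda _ fun j => hmix _
  refine ⟨fun x => star (fun a => ∑ s, P.channelRow l k s * x (s, a)) ⬝ᵥ
    (((1 / √(∫ ω', ∑ m, ‖P.u X l t ω' m‖ ^ 2 ∂μ) : ℝ) : ℂ) •
      precoder (P.S l) (fun j a => ∑ s, P.estimateRow l j s * x (s, a)) t), ?_, ?_⟩
  · exact measurable_star_dotProduct (hmix _)
      (((measurable_precoder (P.S l) t).comp hhat).fun_const_smul _)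
  · funext ω
    rw [Function.comp_apply, ← h_eq_sum, ← funext fun j => hhat_eq_sum X hφ l j ω]
    rfl

lemma indepFun_gain (hφ : Orthonormal ℂ P.φ) (hX : X.IsRayleigh μ) {l l' : Fin L} (hl : l ≠ l')
    (k t : Fin K) : IndepFun (P.gain X μ l k t) (P.gain X μ l' k t) μ := by
  obtain ⟨f, hf, hgain⟩ := exists_measurable_gain_eq (X := X) (μ := μ) hφ l k t
  obtain ⟨f', hf', hgain'⟩ := exists_measurable_gain_eq (X := X) (μ := μ) hφ l' k t
  rw [hgain, hgain']
  exact (hX.indepFun_source hl).comp hf hf'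

lemma exists_measurable_UI_eq (hφ : Orthonormal ℂ P.φ) (k : Fin K) :
    ∃ f : ((Fin L × Fin K × Fin M) ⊕ (Fin L × Fin M) ⊕ (Fin L × Fin M × Fin τ) → ℂ) →
      Fin K → ℂ, Measurable f ∧ (fun ω t => P.UI X μ k t ω) = f ∘ fun ω i => X.family i ω := by
  choose f hf hgain using fun l t => exists_measurable_gain_eq (X := X) (μ := μ) hφ l k t
  refine ⟨fun x t => ∑ l, (√(P.ρ l t) : ℂ) * f l t fun p => x (sourceIndex l p), ?_, ?_⟩
  · exact measurable_pi_lambda _ fun t => Finset.measurable_fun_sum _ fun l _ =>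
      ((hf l t).comp (measurable_pi_lambda _ fun _ => measurable_pi_apply _)).const_mul _
  · funext ω t
    exact Finset.sum_congr rfl fun l _ => congrArg (_ * ·) (congrFun (hgain l t) ω)

lemma PU_eq_UI_sub_CP (k : Fin K) (ω : Ω) : P.PU X μ k ω = P.UI X μ k k ω - P.CP X μ k :=
  Finset.sum_sub_distrib _ _

namespace IsValid

variable [IsProbabilityMeasure μ] (hP : P.IsValid) (hX : X.IsRayleigh μ)
include hP hX

lemma hasMean_sqNorm_w (l : Fin L) (t : Fin K) : HasMean (fun ω => sqNorm (P.w X μ l t ω)) 1 μ := by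
  obtain ⟨d, hd⟩ := hP.exists_card_add_eq l
  exact (hP.isIndepGaussian_hhat l hX).hasMean_sqNorm_normalizedPrecoder
    (fun j => Real.sqrt_pos.mpr (hP.γ_pos l j)) hd t

/-- The precoder depends on the estimates only, so the estimation error adds its variance to that
of the gain through the estimate. -/
lemma hasMeanVariance_gain (l : Fin L) (k t : Fin K) :
    HasMeanVariance (P.gain X μ l k t)
      ((if t = k then √((M - (P.S l).card) * P.γ l k) else 0 : ℝ) : ℂ)
      (P.β l k - P.δ l k * P.γ l k) μ := by
  obtain ⟨d, hd⟩ := hP.exists_card_add_eq l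
  have hM : (M : ℝ) - (P.S l).card = d + 1 := by
    rw [Fintype.card_fin] at hd
    rw [sub_eq_iff_eq_add', ← Nat.cast_add_one, ← Nat.cast_add, hd]
  have hhat := hP.isIndepGaussian_hhat l hX
  have hσ (j) : 0 < √(P.γ l j) := Real.sqrt_pos.mpr (hP.γ_pos l j)
  have herror := hP.isIndepGaussian_error_and_estimates l k hX
  have hgain := (hhat.hasMeanVariance_gain hσ hd k t).star_dotProduct_add (herror.measurable none)
    (herror.law none) (hhat.measurable_normalizedPrecoder (P.S l) t)
    (hhat.hasMean_sqNorm_normalizedPrecoder hσ hd t)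
    (indepFun_normalizedPrecoder_gain (hP.indepFun_error_hhat l k hX) (P.S l) k t)
  convert hgain using 1
  · funext ω
    rw [← add_dotProduct, ← star_add, Option.elim_none, sub_add_cancel]
    rfl
  · rw [hM, Real.sqrt_mul (by positivity)]
  · rw [mul_one, Option.elim_none, Real.sq_sqrt (sub_pos.mpr (hP.γ_lt_β l k)).le, δ]
    split_ifs
    · ring
    · rw [Real.sq_sqrt (hP.γ_pos l k).le]
      ring

lemma CP_eq (k : Fin K) :
    P.CP X μ k = ((∑ l, √((M - (P.S l).card) * P.ρ l k * P.γ l k) : ℝ) : ℂ) := by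
  rw [Complex.ofReal_sum]
  refine Finset.sum_congr rfl fun l _ => ?_
  have hmean : ∫ ω, star (P.h X l k ω) ⬝ᵥ P.w X μ l k ω ∂μ = _ :=
    (hP.hasMeanVariance_gain hX l k k).mean
  rw [hmean, if_pos rfl, ← Complex.ofReal_mul, ← Real.sqrt_mul (hP.ρ_nonneg l k), mul_left_comm,
    mul_assoc]

lemma hasMeanVariance_UI (k t : Fin K) :
    HasMeanVariance (P.UI X μ k t) (if t = k then P.CP X μ k else 0)
      (∑ l, P.ρ l t * (P.β l k - P.δ l k * P.γ l k)) μ := by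
  have hsum := HasMeanVariance.sum_of_pairwise_indepFun
    (fun l => (hP.hasMeanVariance_gain hX l k t).const_mul (√(P.ρ l t) : ℂ))
    fun l l' hl => (indepFun_gain hP.orthonormal hX hl k t).comp
      (φ := ((√(P.ρ l t) : ℂ) * ·)) (ψ := ((√(P.ρ l' t) : ℂ) * ·)) (by fun_prop) (by fun_prop)
  convert hsum using 1
  · rfl
  · split_ifs with htk
    · subst htk
      refine Finset.sum_congr rfl fun l _ => ?_
      exact congrArg (_ * ·) ((hP.hasMeanVariance_gain hX l t t).mean.trans (by rw [if_pos rfl]))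
    · simp
  · simp [Real.sq_sqrt (hP.ρ_nonneg _ t)]

lemma hasMeanVariance_PU (k : Fin K) :
    HasMeanVariance (P.PU X μ k) 0 (∑ l, P.ρ l k * (P.β l k - P.δ l k * P.γ l k)) μ := by
  have hUI := hP.hasMeanVariance_UI hX k k
  rw [if_pos rfl] at hUI
  rw [funext (PU_eq_UI_sub_CP k)]
  refine ⟨hUI.memLp.sub (memLp_const _), ?_, by simpa using hUI.variance⟩
  rw [integral_sub (hUI.memLp.integrable one_le_two) (integrable_const _), hUI.mean]
  simp

lemma SINR_eq (k : Fin K) :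
    P.SINR X μ k = (∑ l, √((M - (P.S l).card) * P.ρ l k * P.γ l k)) ^ 2 /
        (∑ t, ∑ l, P.ρ l t * (P.β l k - P.δ l k * P.γ l k) + 1) := by
  have hUI (t) (ht : t ∈ Finset.univ.erase k) : ∫ ω, ‖P.UI X μ k t ω‖ ^ 2 ∂μ
      = ∑ l, P.ρ l t * (P.β l k - P.δ l k * P.γ l k) := by
    simp [(hP.hasMeanVariance_UI hX k t).integral_norm_sq, Finset.ne_of_mem_erase ht]
  rw [SINR, hP.CP_eq hX, Complex.norm_real, Real.norm_eq_abs, sq_abs,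
    (hP.hasMeanVariance_PU hX k).integral_norm_sq, Finset.sum_congr rfl hUI, norm_zero,
    zero_pow two_ne_zero, add_zero,
    Finset.add_sum_erase _ (fun t => ∑ l, P.ρ l t * (P.β l k - P.δ l k * P.γ l k))
      (Finset.mem_univ k)]

end IsValid

end Params

end Gain

section MutualInformation

lemma ofReal_integral_le_klDiv {α : Type*} [MeasurableSpace α] {μ ν : Measure α}
    [IsProbabilityMeasure μ] [IsProbabilityMeasure ν] {f : α → ℝ} (hf : Integrable f μ)
    (hexp : HasMean (fun x => Real.exp (f x)) 1 ν) :
    ENNReal.ofReal (∫ x, f x ∂μ) ≤ InformationTheory.klDiv μ ν := by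
  by_cases htop : InformationTheory.klDiv μ ν = ∞
  · exact htop ▸ le_top
  obtain ⟨hac, hllr⟩ := InformationTheory.klDiv_ne_top_iff.mp htop
  have : IsProbabilityMeasure (ν.tilted f) := isProbabilityMeasure_tilted hexp.integrable
  have hgibbs := InformationTheory.integral_llr_add_sub_measure_univ_nonneg
    (hac.trans (absolutelyContinuous_tilted hexp.integrable))
    (integrable_llr_tilted_right hac hf hllr hexp.integrable)
  rw [integral_llr_tilted_right hac hf hexp.integrable hllr, hexp.mean] at hgibbs
  rw [InformationTheory.klDiv_of_ac_of_integrable hac hllr]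
  refine ENNReal.ofReal_le_ofReal ?_
  simp only [Real.log_one, probReal_univ] at hgibbs ⊢
  linarith

/-- The log-likelihood ratio of `CN(b, v)` against `CN(0, 1)`. -/
def complexGaussianLLR (b : ℂ) (v : ℝ) (s : ℂ) : ℝ := ‖s‖ ^ 2 - ‖s - b‖ ^ 2 / v - Real.log v

lemma measurable_complexGaussianLLR (a : ℂ) (v : ℝ) :
    Measurable fun p : ℂ × ℂ => complexGaussianLLR (a * p.2) v p.1 := by
  unfold complexGaussianLLR
  fun_prop

lemma lintegral_exp_complexGaussianLLR (b : ℂ) {v : ℝ} (hv : 0 < v) :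
    ∫⁻ s, ENNReal.ofReal (Real.exp (complexGaussianLLR b v s)) ∂stdComplexGaussian = 1 := by
  have hdensity (s : ℂ) : ENNReal.ofReal (Real.pi⁻¹ * Real.exp (-‖s‖ ^ 2))
        * ENNReal.ofReal (Real.exp (complexGaussianLLR b v s))
      = ENNReal.ofReal (Real.pi * v)⁻¹ * ENNReal.ofReal (Real.exp (-v⁻¹ * ‖s - b‖ ^ 2)) := by
    have hexponent : -‖s‖ ^ 2 + complexGaussianLLR b v s
        = -Real.log v + -v⁻¹ * ‖s - b‖ ^ 2 := by
      rw [complexGaussianLLR]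
      ring
    rw [← ENNReal.ofReal_mul (by positivity), ← ENNReal.ofReal_mul (by positivity), mul_assoc,
      ← Real.exp_add, hexponent, Real.exp_add, Real.exp_neg, Real.exp_log hv, mul_inv, mul_assoc]
  have hmass : ∫⁻ s : ℂ, ENNReal.ofReal (Real.exp (-v⁻¹ * ‖s‖ ^ 2))
      = ENNReal.ofReal (Real.pi * v) := by
    simpa using lintegral_norm_pow_mul_exp 0 (inv_pos.mpr hv)
  rw [lintegral_stdComplexGaussian (by unfold complexGaussianLLR; fun_prop)]
  simp_rw [hdensity]
  rw [lintegral_const_mul _ (by fun_prop),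
    lintegral_sub_right_eq_self (fun s : ℂ => ENNReal.ofReal (Real.exp (-v⁻¹ * ‖s‖ ^ 2))) b,
    hmass, ← ENNReal.ofReal_mul (by positivity), inv_mul_cancel₀ (by positivity),
    ENNReal.ofReal_one]

lemma hasMean_exp_complexGaussianLLR {ν : Measure ℂ} [IsProbabilityMeasure ν] (a : ℂ) {v : ℝ}
    (hv : 0 < v) : HasMean (fun p : ℂ × ℂ => Real.exp (complexGaussianLLR (a * p.2) v p.1)) 1
      (stdComplexGaussian.prod ν) := by
  have hmeas := (measurable_complexGaussianLLR a v).exp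
  refine hasMean_of_lintegral_ofReal_eq hmeas.aestronglyMeasurable
    (.of_forall fun p => (Real.exp_pos _).le) zero_le_one ?_
  rw [lintegral_prod_symm' _ hmeas.ennreal_ofReal]
  simp [lintegral_exp_complexGaussianLLR _ hv]

variable {Ω : Type*} [MeasurableSpace Ω] {μ : Measure Ω} {s z : Ω → ℂ}

lemma hasMean_norm_sub_mul_sq (hs : MemLp s 2 μ) (hz : MemLp z 2 μ) (a : ℂ) :
    HasMean (fun ω => ‖s ω - a * z ω‖ ^ 2) ((∫ ω, ‖s ω‖ ^ 2 ∂μ) + ‖a‖ ^ 2 * (∫ ω, ‖z ω‖ ^ 2 ∂μ)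
      - 2 * (a * ∫ ω, z ω * star (s ω) ∂μ).re) μ := by
  have hexpand (ω) : ‖s ω - a * z ω‖ ^ 2
      = ‖s ω‖ ^ 2 + ‖a‖ ^ 2 * ‖z ω‖ ^ 2 - 2 * (a * (z ω * star (s ω))).re := by
    simp only [Complex.sq_norm, Complex.normSq_apply, Complex.star_def, Complex.mul_re,
      Complex.mul_im, Complex.sub_re, Complex.sub_im, Complex.conj_re, Complex.conj_im]
    ring
  have hs' := (memLp_two_iff_integrable_sq_norm hs.1).mp hs
  have hz' := ((memLp_two_iff_integrable_sq_norm hz.1).mp hz).const_mul (‖a‖ ^ 2)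
  have hsum : Integrable (fun ω => ‖s ω‖ ^ 2 + ‖a‖ ^ 2 * ‖z ω‖ ^ 2) μ := hs'.add hz'
  have hzs := (integrable_mul_star hz hs).const_mul a
  have hzs_re : Integrable (fun ω => 2 * (a * (z ω * star (s ω))).re) μ := hzs.re.const_mul 2
  have hre : ∫ ω, (a * (z ω * star (s ω))).re ∂μ = (a * ∫ ω, z ω * star (s ω) ∂μ).re := by
    rw [← integral_const_mul]
    exact integral_re hzs
  simp_rw [hexpand]
  refine ⟨hsum.sub hzs_re, ?_⟩
  rw [integral_sub hsum hzs_re, integral_add hs' hz', integral_const_mul, integral_const_mul, hre]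

variable {A : ℂ} {D : ℝ}

/-- `star A / (‖A‖ ^ 2 + D)` is the coefficient of the linear MMSE estimate of `s` from `z`. -/
lemma hasMean_norm_sub_lmmse_sq (hs : MemLp s 2 μ) (hpower : ∫ ω, ‖s ω‖ ^ 2 ∂μ = 1)
    (hz : MemLp z 2 μ) (hA : ∫ ω, z ω * star (s ω) ∂μ = A) (hD : 0 < D)
    (hz2 : ∫ ω, ‖z ω‖ ^ 2 ∂μ = ‖A‖ ^ 2 + D) :
    HasMean (fun ω => ‖s ω - star A / ((‖A‖ ^ 2 + D : ℝ) : ℂ) * z ω‖ ^ 2)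
      (D / (‖A‖ ^ 2 + D)) μ := by
  have : 0 < ‖A‖ ^ 2 + D := by positivity
  have hcorr : star A / ((‖A‖ ^ 2 + D : ℝ) : ℂ) * A
      = ((‖A‖ ^ 2 / (‖A‖ ^ 2 + D) : ℝ) : ℂ) := by
    rw [div_mul_eq_mul_div, Complex.star_def, Complex.conj_mul']
    push_cast
    rfl
  convert hasMean_norm_sub_mul_sq hs hz (star A / ((‖A‖ ^ 2 + D : ℝ) : ℂ)) using 1
  rw [hpower, hz2, hA, hcorr, Complex.ofReal_re, norm_div, norm_star, div_pow, Complex.norm_real,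
    Real.norm_eq_abs, sq_abs]
  field_simp
  ring

lemma hasMeanVariance_of_map_eq_stdComplexGaussian (hs : Measurable s)
    (hlaw : μ.map s = stdComplexGaussian) : HasMeanVariance s 0 1 μ :=
  .of_map (f := id) hs (hlaw ▸ hasMeanVariance_id_stdComplexGaussian)

variable [IsProbabilityMeasure μ]

lemma hasMean_complexGaussianLLR {b : Ω → ℂ} {v : ℝ} (hv : 0 < v)
    (hs : HasMean (fun ω => ‖s ω‖ ^ 2) 1 μ) (herror : HasMean (fun ω => ‖s ω - b ω‖ ^ 2) v μ) :
    HasMean (fun ω => complexGaussianLLR (b ω) v (s ω)) (-Real.log v) μ := by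
  have hdiff : Integrable (fun ω => ‖s ω‖ ^ 2 - ‖s ω - b ω‖ ^ 2 / v) μ :=
    hs.integrable.sub (herror.integrable.div_const v)
  refine ⟨hdiff.sub (integrable_const _), ?_⟩
  unfold complexGaussianLLR
  rw [integral_sub hdiff (integrable_const _),
    integral_sub hs.integrable (herror.integrable.div_const v), integral_div, hs.mean,
    herror.mean, div_self hv.ne', integral_const, probReal_univ, one_smul, sub_self, zero_sub]

/-- The test function of the variational bound is the log-likelihood ratio of the Gaussian channel
with the same first and second moments. -/
lemma ofReal_log_one_add_le_klDiv (hs : Measurable s) (hz : Measurable z)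
    (hlaw : μ.map s = stdComplexGaussian) (hzL2 : MemLp z 2 μ)
    (hA : ∫ ω, z ω * star (s ω) ∂μ = A) (hD : 0 < D) (hz2 : ∫ ω, ‖z ω‖ ^ 2 ∂μ = ‖A‖ ^ 2 + D) :
    ENNReal.ofReal (Real.log (1 + ‖A‖ ^ 2 / D)) ≤
      InformationTheory.klDiv (μ.map fun ω => (s ω, z ω)) ((μ.map s).prod (μ.map z)) := by
  have hmoments := hasMeanVariance_of_map_eq_stdComplexGaussian hs hlaw
  have hpower : HasMean (fun ω => ‖s ω‖ ^ 2) 1 μ :=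
    ⟨(memLp_two_iff_integrable_sq_norm hmoments.memLp.1).mp hmoments.memLp,
      by simp [hmoments.integral_norm_sq]⟩
  set a := star A / ((‖A‖ ^ 2 + D : ℝ) : ℂ)
  set v := D / (‖A‖ ^ 2 + D) with hv
  have hv_pos : 0 < v := by positivity
  have hLLR := hasMean_complexGaussianLLR hv_pos hpower
    (hasMean_norm_sub_lmmse_sq hmoments.memLp hpower.mean hzL2 hA hD hz2)
  have hlog : -Real.log v = Real.log (1 + ‖A‖ ^ 2 / D) := by
    rw [← Real.log_inv, hv, inv_div, add_div, div_self hD.ne', add_comm]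
  have hpair : Measurable fun ω => (s ω, z ω) := hs.prodMk hz
  have hmeas := (measurable_complexGaussianLLR a v).aestronglyMeasurable
    (μ := μ.map fun ω => (s ω, z ω))
  have : IsProbabilityMeasure (μ.map fun ω => (s ω, z ω)) :=
    Measure.isProbabilityMeasure_map hpair.aemeasurable
  have : IsProbabilityMeasure (μ.map z) := Measure.isProbabilityMeasure_map hz.aemeasurable
  rw [← hlog, ← hLLR.mean, ← integral_map hpair.aemeasurable hmeas, hlaw]
  exact ofReal_integral_le_klDiv ((integrable_map_measure hmeas hpair.aemeasurable).mpr
    hLLR.integrable) (hasMean_exp_complexGaussianLLR a hv_pos)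

variable {ι : Type*} [Fintype ι] [DecidableEq ι] {e w : ι → Ω → ℂ} {n : Ω → ℂ} {a : ℂ} {v : ℝ}

/-- The use-and-then-forget bound: the fluctuations of the gain `w k` around its mean `a`, and the
interference of the other symbols, are treated as Gaussian noise. -/
lemma IsWhite.ofReal_log_one_add_le_klDiv (he : IsWhite e 1 μ) (he_meas : ∀ i, Measurable (e i))
    (hw_meas : ∀ i, Measurable (w i)) (hw : ∀ i, MemLp (w i) 2 μ) (hn : Measurable n)
    (hn_law : μ.map n = stdComplexGaussian)
    (hew : IndepFun (fun ω i => e i ω) (fun ω i => w i ω) μ)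
    (hnew : IndepFun n (fun ω => (fun i => e i ω, fun i => w i ω)) μ) {k : ι}
    (hk_law : μ.map (e k) = stdComplexGaussian) (hk : HasMeanVariance (w k) a v μ) :
    ENNReal.ofReal (Real.log (1 + ‖a‖ ^ 2 /
        (v + (∑ i ∈ Finset.univ.erase k, ∫ ω, ‖w i ω‖ ^ 2 ∂μ) + 1))) ≤
      InformationTheory.klDiv (μ.map fun ω => (e k ω, n ω + ∑ i, e i ω * w i ω))
        ((μ.map (e k)).prod (μ.map fun ω => n ω + ∑ i, e i ω * w i ω)) := by
  have hnoise := hasMeanVariance_of_map_eq_stdComplexGaussian hn hn_law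
  have hsignal := he.memLp_sum_mul hw (indepFun_apply_apply hew)
  have hn_signal : ∫ ω, n ω * star (∑ i, e i ω * w i ω) ∂μ = 0 :=
    integral_mul_star_of_indepFun (hnew.comp (φ := id)
      (ψ := fun p : (ι → ℂ) × (ι → ℂ) => ∑ i, p.1 i * p.2 i) measurable_id (by fun_prop))
      hnoise.memLp hsignal hnoise.mean
  have hn_symbol : ∫ ω, n ω * star (e k ω) ∂μ = 0 :=
    integral_mul_star_of_indepFun (hnew.comp (φ := id)
      (ψ := fun p : (ι → ℂ) × (ι → ℂ) => p.1 k) measurable_id (by fun_prop))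
      hnoise.memLp (he.memLp k) hnoise.mean
  refine CellFree.ofReal_log_one_add_le_klDiv (he_meas k) (by fun_prop) hk_law
    (hnoise.memLp.add hsignal) ?_ ?_ ?_
  · simp_rw [add_mul]
    rw [integral_add (integrable_mul_star hnoise.memLp (he.memLp k))
      (integrable_mul_star hsignal (he.memLp k)), hn_symbol,
      he.integral_sum_mul_mul_star hw hew, hk.mean, Complex.ofReal_one, one_mul, zero_add]
  · have hv : 0 ≤ v := hk.variance ▸ integral_nonneg fun ω => sq_nonneg _
    have : 0 ≤ ∑ i ∈ Finset.univ.erase k, ∫ ω, ‖w i ω‖ ^ 2 ∂μ :=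
      Finset.sum_nonneg fun i _ => integral_nonneg fun ω => sq_nonneg _
    positivity
  · rw [integral_norm_add_sq hnoise.memLp hsignal hn_signal,
      he.integral_norm_sum_mul_sq hw hew, ← Finset.add_sum_erase _ _ (Finset.mem_univ k),
      hk.integral_norm_sq, hnoise.integral_norm_sq, norm_zero]
    ring

end MutualInformation

section Achievability

variable {L K M τ : ℕ} {Ω : Type*} [MeasurableSpace Ω] {μ : Measure Ω} {X : Block L K M τ Ω}
  {s : Fin K → Ω → ℂ} {n : Ω → ℂ} {k : Fin K}

lemma IsDownlinkInput.isWhite (hs : IsDownlinkInput X μ k s n) : IsWhite s 1 μ where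
  memLp t := by
    refine (memLp_two_iff_integrable_sq_norm (hs.measurable_s t).aestronglyMeasurable).mpr ?_
    exact not_imp_comm.mp integral_undef (hs.power t ▸ one_ne_zero)
  power := hs.power
  uncorrelated := hs.uncorrelated

variable [NeZero K] {P : Params L K M τ}

lemma Params.z_eq (s : Fin K → Ω → ℂ) (n : Ω → ℂ) (k : Fin K) (ω : Ω) :
    P.z X μ s n k ω = n ω + ∑ t, s t ω * P.UI X μ k t ω := by
  rw [z, add_comm]
  simp only [x, UI, dotProduct_sum, dotProduct_smul, smul_eq_mul, Finset.mul_sum]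
  rw [Finset.sum_comm]
  congr! 3
  ring

lemma Params.IsValid.SE_le_mutualInfo [IsProbabilityMeasure μ] (hP : P.IsValid)
    (hX : X.IsRayleigh μ) (hs : IsDownlinkInput X μ k s n) :
    ENNReal.ofReal (P.SE X μ k) ≤ mutualInfo (s k) (P.z X μ s n k) μ := by
  obtain ⟨f, hf, hUI⟩ := exists_measurable_UI_eq (X := X) (μ := μ) hP.orthonormal k
  have hUI_meas : Measurable fun ω t => P.UI X μ k t ω :=
    hUI ▸ hf.comp (measurable_pi_lambda _ hX.measurable)
  have hs_UI : IndepFun (fun ω t => s t ω) (fun ω t => P.UI X μ k t ω) μ :=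
    hUI ▸ hs.indep_s.comp measurable_id hf
  have hn_UI : IndepFun n (fun ω => (fun t => s t ω, fun t => P.UI X μ k t ω)) μ := by
    have hpair : (fun ω => (fun t => s t ω, fun t => P.UI X μ k t ω))
        = Prod.map id f ∘ fun ω => (fun t => s t ω, fun i => X.family i ω) :=
      funext fun ω => Prod.ext rfl (congrFun hUI ω)
    exact hpair ▸ hs.indep_n.comp measurable_id (measurable_id.prodMap hf)
  have hk := hP.hasMeanVariance_UI hX k k
  rw [if_pos rfl] at hk
  have hPU : ∫ ω, ‖P.PU X μ k ω‖ ^ 2 ∂μ = _ :=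
    (hP.hasMeanVariance_PU hX k).integral_norm_sq
  rw [norm_zero, zero_pow two_ne_zero, add_zero] at hPU
  rw [mutualInfo, funext (z_eq s n k), SE, SINR, hPU, Real.logb,
    ENNReal.ofReal_div_of_pos (Real.log_pos one_lt_two)]
  exact ENNReal.div_le_div_right (hs.isWhite.ofReal_log_one_add_le_klDiv hs.measurable_s
    (measurable_pi_iff.mp hUI_meas) (fun t => (hP.hasMeanVariance_UI hX k t).memLp) hs.measurable_n
    hs.law_n hs_UI hn_UI hs.law_s hk) _

end Achievability

end CellFree

end

theorem proposition1 {L K M τ : ℕ} [NeZero K]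
    {Ω : Type*} [MeasurableSpace Ω] (μ : Measure Ω) [IsProbabilityMeasure μ]
    (P : CellFree.Params L K M τ) (X : CellFree.Block L K M τ Ω)
    (hβ : ∀ l k, 0 < P.β l k) (hβE : ∀ l, 0 ≤ P.βE l)
    (hρu : 0 < P.ρu) (hρE : 0 ≤ P.ρE) (hρ : ∀ l k, 0 ≤ P.ρ l k)
    (hφ : Orthonormal ℂ P.φ) (hS : ∀ l, (P.S l).card < M)
    (hX : X.IsRayleigh μ) (k : Fin K) :
    -- the precoding vectors have unit mean power, and all expectations in the SINR exist
    (∀ l t, Integrable (fun ω => ∑ m, ‖P.w X μ l t ω m‖ ^ 2) μ ∧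
      ∫ ω, ∑ m, ‖P.w X μ l t ω m‖ ^ 2 ∂μ = 1) ∧
    (∀ l, Integrable (fun ω => star (P.h X l k ω) ⬝ᵥ P.w X μ l k ω) μ) ∧
    Integrable (fun ω => ‖P.PU X μ k ω‖ ^ 2) μ ∧
    (∀ t, Integrable (fun ω => ‖P.UI X μ k t ω‖ ^ 2) μ) ∧
    -- closed form of the SINR and of the spectral efficiency
    P.SINR X μ k =
      (∑ l, √(((M : ℝ) - (P.S l).card) * P.ρ l k * P.γ l k)) ^ 2 /
        (∑ t, ∑ l, P.ρ l t * (P.β l k - P.δ l k * P.γ l k) + 1) ∧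
    P.SE X μ k = Real.logb 2 (1 +
      (∑ l, √(((M : ℝ) - (P.S l).card) * P.ρ l k * P.γ l k)) ^ 2 /
        (∑ t, ∑ l, P.ρ l t * (P.β l k - P.δ l k * P.γ l k) + 1)) ∧
    -- the spectral efficiency is achievable
    (∀ (s : Fin K → Ω → ℂ) (n : Ω → ℂ), CellFree.IsDownlinkInput X μ k s n →
      ENNReal.ofReal (P.SE X μ k) ≤ CellFree.mutualInfo (s k) (P.z X μ s n k) μ) := by
  have hP : P.IsValid := ⟨hβ, hβE, hρu, hρE, hρ, hφ, hS⟩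
  have hPU := (hP.hasMeanVariance_PU hX k).memLp
  have hUI t := (hP.hasMeanVariance_UI hX k t).memLp
  refine ⟨fun l t => ⟨(hP.hasMean_sqNorm_w hX l t).integrable, (hP.hasMean_sqNorm_w hX l t).mean⟩,
    fun l => (hP.hasMeanVariance_gain hX l k k).memLp.integrable one_le_two,
    (memLp_two_iff_integrable_sq_norm hPU.1).mp hPU,
    fun t => (memLp_two_iff_integrable_sq_norm (hUI t).1).mp (hUI t),
    hP.SINR_eq hX k, ?_, fun s n hs => hP.SE_le_mutualInfo hX hs⟩
  rw [CellFree.Params.SE, hP.SINR_eq hX k]
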